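/- **Notation.** Let $n\ge 1$ and $1<p<\infty$. A weight in $\mathbb R^n$ is a function $\omega\in L^1_{\mathrm{loc}}(\mathbb R^n)$ with $\omega>0$ almost everywhere. It is an $A_p$ weight if there is $A>0$ such that, for every cube $Q\subset\mathbb R^n$ with sides parallel to the axes, $$\Big(\frac1{|Q|}\int_Q\omega\,dx\Big)\Big(\frac1{|Q|}\int_Q\omega^{-1/(p-1)}\,dx\Big)^{p-1}\le A,$$ and $[\omega]_{A_p}$ is the infimum of all such $A$. Let $\operatorname{dist}(x,\emptyset)=\infty$. For an open set $G\subset\mathbb R^n$, a function $R:G\to\mathbb R$ with $0\le R(x)\le\operatorname{dist}(x,\partial G)$ for all $x\in G$, and $f\in L^p(G)$ (real or complex valued), put $$M_R(f)(x)=\sup_{0\le r\le R(x)}\frac1{|B(x,r)|}\int_{B(x,r)}|f(y)|\,dy,\qquad x\in G,$$ where $B(x,r)$ is the open ball and the average for $r=0$ is understood as $|f(x)|$. **Theorem.** Let $n\ge 1$ and $1<p<\infty$. For every $A_p$ weight $\omega$ in $\mathbb R^n$ there is a constant $C>0$, depending only on $n$, $p$ and $[\omega]_{A_p}$, such that the following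 holds. Let $\emptyset\ne G\subset\mathbb R^n$ be open, let $0\le s\le 2$, and let $R:G\to\mathbb R$ be a measurable function with $0\le R(x)\le\operatorname{dist}(x,\partial G)$ for every $x\in G$. Then, for every $f\in L^p(G)$, the function $M_R(f)$ is finite almost everywhere in $G$ and $$\int_G\int_G\frac{|M_R(f)(x)-M_R(f)(y)|^p}{(|x-y|+|R(x)-R(y)|)^{sp}}\,\omega(x-y)\,dy\,dx\le C\int_G\int_G\frac{|f(x)-f(y)|^p}{|x-y|^{sp}}\,\omega(x-y)\,dy\,dx.$$ (The right-hand side may be infinite.) -/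

import Mathlib

open MeasureTheory
open scoped ENNReal

noncomputable section

namespace FracMaximal

/-- The closed cube in `ℝⁿ` with centre `c` and side length `2 * r`, sides parallel to the axes. -/
def cube {n : ℕ} (c : EuclideanSpace ℝ (Fin n)) (r : ℝ) : Set (EuclideanSpace ℝ (Fin n)) :=
  {y | ∀ i, |y i - c i| ≤ r}

/-- A weight in `ℝⁿ`: a locally integrable function that is positive almost everywhere. -/
def IsWeight {n : ℕ} (ω : EuclideanSpace ℝ (Fin n) → ℝ) : Prop :=
  LocallyIntegrable ω volume ∧ ∀ᵐ x, 0 < ω x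

/-- The `A_p` inequality with constant `A`, for every cube. The averages are taken in `[0, ∞]`, so
that the inequality contains the local integrability of `ω ^ (-1/(p-1))`. -/
def ApBound {n : ℕ} (p : ℝ) (ω : EuclideanSpace ℝ (Fin n) → ℝ) (A : ℝ) : Prop :=
  ∀ (c : EuclideanSpace ℝ (Fin n)) (r : ℝ), 0 < r →
    (⨍⁻ x in cube c r, ENNReal.ofReal (ω x) ∂volume) *
      (⨍⁻ x in cube c r, ENNReal.ofReal (ω x) ^ (-1 / (p - 1)) ∂volume) ^ (p - 1)
        ≤ ENNReal.ofReal A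

/-- `ω` is a Muckenhoupt `A_p` weight. -/
def IsApWeight {n : ℕ} (p : ℝ) (ω : EuclideanSpace ℝ (Fin n) → ℝ) : Prop :=
  IsWeight ω ∧ ∃ A : ℝ, 0 < A ∧ ApBound p ω A

/-- The `A_p` constant `[ω]_{A_p}`: the infimum of the admissible constants. -/
def apConst {n : ℕ} (p : ℝ) (ω : EuclideanSpace ℝ (Fin n) → ℝ) : ℝ :=
  sInf {A : ℝ | 0 < A ∧ ApBound p ω A}

/-- The average of `|f|` over the open ball `B(x, r)`, with value `|f x|` for `r = 0`. -/
def ballAverage {n : ℕ} {𝕜 : Type*} [RCLike 𝕜] (f : EuclideanSpace ℝ (Fin n) → 𝕜)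
    (x : EuclideanSpace ℝ (Fin n)) (r : ℝ) : ℝ≥0∞ :=
  if r = 0 then ‖f x‖ₑ else ⨍⁻ y in Metric.ball x r, ‖f y‖ₑ ∂volume

/-- The maximal function `M_R f (x)`, the supremum of the averages of `|f|` over the balls `B(x, r)`
with `0 ≤ r ≤ R x`, as an element of `[0, ∞]`. If `x ∈ G` and `R x ≤ dist(x, ∂G)`, these balls lie
in `G`, so the values of `f` outside `G` play no role. -/
def maximalFunction {n : ℕ} {𝕜 : Type*} [RCLike 𝕜] (R : EuclideanSpace ℝ (Fin n) → ℝ)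
    (f : EuclideanSpace ℝ (Fin n) → 𝕜) (x : EuclideanSpace ℝ (Fin n)) : ℝ≥0∞ :=
  ⨆ r ∈ Set.Icc (0 : ℝ) (R x), ballAverage f x r

/-- The `p`-th power of the fractional weighted Sobolev seminorm,
`∫_G ∫_G |u(x) - u(y)|^p / |x - y|^{sp} ω(x - y) dy dx`, with values in `[0, ∞]`.
On the diagonal the integrand is `0`. -/
def seminormPow {n : ℕ} {𝕜 : Type*} [RCLike 𝕜] (G : Set (EuclideanSpace ℝ (Fin n))) (s p : ℝ)
    (ω : EuclideanSpace ℝ (Fin n) → ℝ) (u : EuclideanSpace ℝ (Fin n) → 𝕜) : ℝ≥0∞ :=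
  ∫⁻ x in G, ∫⁻ y in G,
    ‖u x - u y‖ₑ ^ p / ENNReal.ofReal ‖x - y‖ ^ (s * p) * ENNReal.ofReal (ω (x - y))

/-- The `p`-th power of the `R`-modified fractional weighted Sobolev seminorm,
`∫_G ∫_G |u(x) - u(y)|^p / (|x - y| + |R(x) - R(y)|)^{sp} ω(x - y) dy dx`,
with values in `[0, ∞]`. -/
def modifiedSeminormPow {n : ℕ} {𝕜 : Type*} [RCLike 𝕜] (G : Set (EuclideanSpace ℝ (Fin n)))
    (R : EuclideanSpace ℝ (Fin n) → ℝ) (s p : ℝ)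
    (ω : EuclideanSpace ℝ (Fin n) → ℝ) (u : EuclideanSpace ℝ (Fin n) → 𝕜) : ℝ≥0∞ :=
  ∫⁻ x in G, ∫⁻ y in G,
    ‖u x - u y‖ₑ ^ p / ENNReal.ofReal (‖x - y‖ + |R x - R y|) ^ (s * p) *
      ENNReal.ofReal (ω (x - y))

end FracMaximal

end

/-!
Let `S x y = |f x - f y| / |x - y| ^ s` on `G × G` and `d = |x - y| + |R x - R y|`. A ball of radius
`r ≤ d` about `x` is compared with the point `y`; a larger ball `B(x, r)` is compared with
`B(y, r - d)`, whose radius is at most `R y`. Either way `|M_R f x - M_R f y|` is at most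
`(2 * d) ^ s` times a sum of maximal functions of `S` in one of its variables or along the diagonal
direction, and of compositions of two of these. Each of them is bounded on `L^p` with respect to
`ω (x - y) dx dy`: the diagonal one because `x - y` is constant along the diagonal, the other two by
Muckenhoupt's theorem in one variable. Muckenhoupt's theorem is proved by Lerner's argument, which
bounds the maximal function by iterating the maximal operators of the measures
`ω ^ (-1 / (p - 1)) dx` and `ω dx`.
-/

noncomputable section

namespace FracMaximal

open Set Metric

lemma setLAverage_le_add_mul {X : Type*} [MeasurableSpace X] {μ : Measure X} {s : Set X}
    (hs : MeasurableSet s) {g a k : X → ℝ≥0∞} {T : ℝ≥0∞} (ha : Measurable a) (hT : T ≠ ∞)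
    (h : ∀ z ∈ s, g z ≤ a z + T * k z) :
    ⨍⁻ z in s, g z ∂μ ≤ ⨍⁻ z in s, a z ∂μ + T * ⨍⁻ z in s, k z ∂μ := by
  simp only [setLAverage_eq]
  rw [← mul_div_assoc, ← ENNReal.add_div, ← lintegral_const_mul' _ _ hT, ← lintegral_add_left ha]
  gcongr 1
  exact setLIntegral_mono' hs h

lemma setLAverage_le_const_add_mul {X : Type*} [MeasurableSpace X] {μ : Measure X} {s : Set X}
    (hs : MeasurableSet s) {g k : X → ℝ≥0∞} {a T : ℝ≥0∞} (hT : T ≠ ∞)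
    (h : ∀ z ∈ s, g z ≤ a + T * k z) :
    ⨍⁻ z in s, g z ∂μ ≤ a + T * ⨍⁻ z in s, k z ∂μ := by
  refine (setLAverage_le_add_mul hs measurable_const hT h).trans ?_
  gcongr
  rw [setLAverage_eq, setLIntegral_const]
  exact ENNReal.div_le_of_le_mul le_rfl

section LayerCake

lemma lintegral_Ioi_rpow_eq_top (s : ℝ) : ∫⁻ t in Ioi (0 : ℝ), ENNReal.ofReal (t ^ s) = ∞ := by
  by_contra h
  have hnonneg : 0 ≤ᵐ[volume.restrict (Ioi (0 : ℝ))] fun t => t ^ s :=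
    (ae_restrict_mem measurableSet_Ioi).mono fun t ht => Real.rpow_nonneg (mem_Ioi.1 ht).le s
  exact not_integrableOn_Ioi_rpow s <|
    (lintegral_ofReal_ne_top_iff_integrable (by fun_prop) hnonneg).1 h

lemma lintegral_rpow_eq_lintegral_meas_ofReal_lt_mul {X : Type*} [MeasurableSpace X]
    {μ : Measure X} {f : X → ℝ≥0∞} (hf : AEMeasurable f μ) {q : ℝ} (hq : 0 < q) :
    ∫⁻ x, f x ^ q ∂μ = ENNReal.ofReal q *
      ∫⁻ t in Ioi (0 : ℝ), μ {x | ENNReal.ofReal t < f x} * ENNReal.ofReal (t ^ (q - 1)) := by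
  by_cases htop : μ {x | f x = ∞} = 0
  · have hfin : ∀ᵐ x ∂μ, f x ≠ ∞ := by simpa only [ae_iff, not_not] using htop
    calc ∫⁻ x, f x ^ q ∂μ
        = ∫⁻ x, ENNReal.ofReal ((f x).toReal ^ q) ∂μ := by
          refine lintegral_congr_ae (hfin.mono fun x hx => ?_)
          simp only [← ENNReal.ofReal_rpow_of_nonneg ENNReal.toReal_nonneg hq.le,
            ENNReal.ofReal_toReal hx]
      _ = ENNReal.ofReal q *
            ∫⁻ t in Ioi (0 : ℝ), μ {x | t < (f x).toReal} * ENNReal.ofReal (t ^ (q - 1)) :=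
          lintegral_rpow_eq_lintegral_meas_lt_mul μ
            (Filter.Eventually.of_forall fun _ => ENNReal.toReal_nonneg) hf.ennreal_toReal hq
      _ = _ := by
          congr 1
          refine setLIntegral_congr_fun measurableSet_Ioi fun t ht => ?_
          congr 1
          refine measure_congr (hfin.mono fun x hx => propext ?_)
          exact (ENNReal.ofReal_lt_iff_lt_toReal (mem_Ioi.1 ht).le hx).symm
  · have hleft : ∫⁻ x, f x ^ q ∂μ = ∞ := by
      refine lintegral_eq_top_of_measure_eq_top_ne_zero (hf.pow_const q) ?_
      simpa only [ENNReal.rpow_eq_top_iff_of_pos hq] using htop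
    have hright : ∫⁻ t in Ioi (0 : ℝ),
        μ {x | ENNReal.ofReal t < f x} * ENNReal.ofReal (t ^ (q - 1)) = ∞ := by
      refine top_le_iff.1 ?_
      calc ∞ = μ {x | f x = ∞} * ∫⁻ t in Ioi (0 : ℝ), ENNReal.ofReal (t ^ (q - 1)) := by
            rw [lintegral_Ioi_rpow_eq_top, ENNReal.mul_top htop]
        _ = ∫⁻ t in Ioi (0 : ℝ), μ {x | f x = ∞} * ENNReal.ofReal (t ^ (q - 1)) :=
            (lintegral_const_mul _ (by fun_prop)).symm
        _ ≤ _ := by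
            gcongr with t x
            exact fun hx => hx ▸ ENNReal.ofReal_lt_top
    rw [hleft, hright, ENNReal.mul_top (by simpa using hq)]

end LayerCake

section HardyLittlewood

variable {X : Type*} [PseudoMetricSpace X] [MeasurableSpace X]

/-- The doubling condition for a measure. The factor `6` absorbs the enlargement in the Vitali
covering lemma. -/
structure IsDoubling (μ : Measure X) (D : ℝ≥0∞) : Prop where
  ne_top : D ≠ ∞
  measure_ball_le : ∀ (c : X) {r : ℝ}, 0 < r → μ (ball c (6 * r)) ≤ D * μ (ball c r)

lemma IsDoubling.one_le [Nonempty X] [ProperSpace X] {μ : Measure X} [μ.IsOpenPosMeasure]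
    [IsFiniteMeasureOnCompacts μ] {D : ℝ≥0∞} (hμ : IsDoubling μ D) : 1 ≤ D := by
  obtain ⟨c⟩ := ‹Nonempty X›
  have h : μ (ball c 1) ≤ D * μ (ball c 1) :=
    (measure_mono (ball_subset_ball (by norm_num))).trans (hμ.measure_ball_le c one_pos)
  refine (ENNReal.mul_le_mul_iff_left (measure_ball_pos μ c one_pos).ne'
    measure_ball_lt_top.ne).1 ?_
  rwa [one_mul]

lemma IsDoubling.mul_measure_iUnion_ball_le [OpensMeasurableSpace X] {μ : Measure X} {D : ℝ≥0∞}
    (hμ : IsDoubling μ D) {h : X → ℝ≥0∞} {t : ℝ≥0∞} {ι : Type*} [Countable ι] {c : ι → X}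
    {r : ι → ℝ} (hr : ∀ i, 0 < r i) {N : ℝ} (hrN : ∀ i, r i ≤ N)
    (ht : ∀ i, t < ⨍⁻ y in ball (c i) (r i), h y ∂μ) :
    t * μ (⋃ i, ball (c i) (r i)) ≤ D * ∫⁻ x, h x ∂μ := by
  obtain ⟨u, -, hdisj, hcov⟩ := Vitali.exists_disjoint_subfamily_covering_enlargement_closedBall
    univ c r N (fun i _ => hrN i) 5 (by norm_num)
  have hu : u.Countable := to_countable u
  have hsub : ⋃ i, ball (c i) (r i) ⊆ ⋃ i ∈ u, ball (c i) (6 * r i) := by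
    refine iUnion_subset fun i x hx => ?_
    obtain ⟨j, hj, hij⟩ := hcov i (mem_univ i)
    refine mem_biUnion hj (closedBall_subset_ball ?_ (hij (ball_subset_closedBall hx)))
    linarith [hr j]
  calc t * μ (⋃ i, ball (c i) (r i))
      ≤ t * ∑' i : u, D * μ (ball (c i) (r i)) := by
        gcongr
        exact (measure_mono hsub).trans ((measure_biUnion_le μ hu _).trans
          (ENNReal.tsum_le_tsum fun i => hμ.measure_ball_le _ (hr i)))
    _ = D * ∑' i : u, t * μ (ball (c i) (r i)) := by
        rw [ENNReal.tsum_mul_left, ENNReal.tsum_mul_left]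
        ring
    _ ≤ D * ∑' i : u, ∫⁻ x in ball (c i) (r i), h x ∂μ := by
        gcongr with i
        have hi := ht i
        rw [setLAverage_eq] at hi
        exact (ENNReal.mul_lt_of_lt_div hi).le
    _ = D * ∫⁻ x in ⋃ i ∈ u, ball (c i) (r i), h x ∂μ := by
        rw [lintegral_biUnion hu (fun i _ => measurableSet_ball)
          (hdisj.mono fun i => ball_subset_closedBall)]
    _ ≤ D * ∫⁻ x, h x ∂μ := by
        gcongr
        exact Measure.restrict_le_self

variable [TopologicalSpace.SeparableSpace X] [Nonempty X]

/-- The balls with positive rational radius and centre in a fixed countable dense set. -/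
def rationalBall (X : Type*) [PseudoMetricSpace X] [TopologicalSpace.SeparableSpace X] [Nonempty X]
    (i : ℕ × {q : ℚ // 0 < q}) : Set X :=
  ball (TopologicalSpace.denseSeq X i.1) (i.2 : ℚ)

/-- The uncentred Hardy–Littlewood maximal function. The supremum is restricted to the countable
family `rationalBall X`, which makes it measurable jointly with parameters. -/
def uncenteredMaximal (μ : Measure X) (h : X → ℝ≥0∞) (x : X) : ℝ≥0∞ :=
  ⨆ i, (rationalBall X i).indicator (fun _ => ⨍⁻ y in rationalBall X i, h y ∂μ) x

variable {μ : Measure X} {g h : X → ℝ≥0∞} {x : X}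

lemma lt_uncenteredMaximal_iff {t : ℝ≥0∞} :
    t < uncenteredMaximal μ h x ↔
      ∃ i, x ∈ rationalBall X i ∧ t < ⨍⁻ y in rationalBall X i, h y ∂μ := by
  rw [uncenteredMaximal, lt_iSup_iff]
  refine exists_congr fun i => ?_
  by_cases hx : x ∈ rationalBall X i <;> simp [hx]

lemma setLAverage_le_uncenteredMaximal {i} (hx : x ∈ rationalBall X i) :
    ⨍⁻ y in rationalBall X i, h y ∂μ ≤ uncenteredMaximal μ h x :=
  le_of_forall_lt fun _ ht => lt_uncenteredMaximal_iff.2 ⟨i, hx, ht⟩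

lemma uncenteredMaximal_le {b : ℝ≥0∞}
    (hb : ∀ i, x ∈ rationalBall X i → ⨍⁻ y in rationalBall X i, h y ∂μ ≤ b) :
    uncenteredMaximal μ h x ≤ b :=
  le_of_forall_lt fun _ ht =>
    let ⟨i, hx, hlt⟩ := lt_uncenteredMaximal_iff.1 ht
    hlt.trans_le (hb i hx)

lemma IsDoubling.setLAverage_ball_le {D : ℝ≥0∞} (hμ : IsDoubling μ D) {c : X} {r : ℝ}
    (hr : 0 < r) (hx : dist x c ≤ 2 * r) :
    ⨍⁻ y in ball c r, h y ∂μ ≤ D * uncenteredMaximal μ h x := by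
  obtain ⟨j, hj⟩ := (TopologicalSpace.denseRange_denseSeq X).exists_dist_lt c hr
  obtain ⟨q, hq, hq'⟩ := exists_rat_btwn (show 3 * r < 4 * r by linarith)
  have hq0 : 0 < q := by exact_mod_cast (by positivity : 0 < 3 * r).trans hq
  let i : ℕ × {q : ℚ // 0 < q} := (j, ⟨q, hq0⟩)
  have hxi : x ∈ rationalBall X i :=
    mem_ball.2 (by linarith [dist_triangle x c (TopologicalSpace.denseSeq X j)])
  have hsub : ball c r ⊆ rationalBall X i := ball_subset_ball' (by linarith)
  have hμi : μ (rationalBall X i) ≤ D * μ (ball c r) := by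
    refine (measure_mono (ball_subset_ball' ?_)).trans (hμ.measure_ball_le c hr)
    rw [dist_comm] at hj
    linarith
  rw [setLAverage_eq]
  rcases eq_or_ne (μ (ball c r)) ∞ with htop | htop
  · simp [htop]
  refine ENNReal.div_le_of_le_mul ?_
  calc ∫⁻ y in ball c r, h y ∂μ
      ≤ ∫⁻ y in rationalBall X i, h y ∂μ := lintegral_mono_set hsub
    _ = μ (rationalBall X i) * ⨍⁻ y in rationalBall X i, h y ∂μ :=
        (measure_mul_setLAverage _ <|
          ne_top_of_le_ne_top (ENNReal.mul_ne_top hμ.ne_top htop) hμi).symm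
    _ ≤ D * μ (ball c r) * uncenteredMaximal μ h x := by
        gcongr
        exact setLAverage_le_uncenteredMaximal hxi
    _ = D * uncenteredMaximal μ h x * μ (ball c r) := by ring

section Measurability

variable [OpensMeasurableSpace X]

lemma measurableSet_rationalBall (i) : MeasurableSet (rationalBall X i) := measurableSet_ball

lemma measurable_uncenteredMaximal_prod {Y : Type*} [MeasurableSpace Y] [SFinite μ]
    {F : X → Y → ℝ≥0∞} (hF : Measurable (Function.uncurry F)) :
    Measurable fun q : X × Y => uncenteredMaximal μ (fun z => F z q.2) q.1 := by
  refine Measurable.iSup fun i => ?_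
  have havg : Measurable fun y => ⨍⁻ z in rationalBall X i, F z y ∂μ := by
    simp only [setLAverage_eq]
    exact hF.lintegral_prod_left'.div_const _
  have hset : MeasurableSet {q : X × Y | q.1 ∈ rationalBall X i} :=
    measurable_fst (measurableSet_rationalBall i)
  exact (havg.comp measurable_snd).indicator hset

lemma measurable_uncenteredMaximal : Measurable (uncenteredMaximal μ h) :=
  Measurable.iSup fun i => measurable_const.indicator (measurableSet_rationalBall i)

end Measurability

section WeakType

variable [OpensMeasurableSpace X] {D : ℝ≥0∞}

lemma uncenteredMaximal_le_add {a : ℝ≥0∞} (hgh : ∀ y, h y ≤ a + g y) :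
    uncenteredMaximal μ h x ≤ a + uncenteredMaximal μ g x :=
  uncenteredMaximal_le fun i hx =>
    calc ⨍⁻ y in rationalBall X i, h y ∂μ
        ≤ a + 1 * ⨍⁻ y in rationalBall X i, g y ∂μ :=
          setLAverage_le_const_add_mul (measurableSet_rationalBall i) ENNReal.one_ne_top
            fun y _ => by simpa only [one_mul] using hgh y
      _ ≤ a + uncenteredMaximal μ g x := by
          rw [one_mul]
          gcongr
          exact setLAverage_le_uncenteredMaximal hx

lemma IsDoubling.mul_measure_lt_uncenteredMaximal_le (hμ : IsDoubling μ D) (h : X → ℝ≥0∞)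
    (t : ℝ≥0∞) : t * μ {x | t < uncenteredMaximal μ h x} ≤ D * ∫⁻ x, h x ∂μ := by
  let I : ℕ → Set (ℕ × {q : ℚ // 0 < q}) := fun N =>
    {i | ((i.2 : ℚ) : ℝ) ≤ N ∧ t < ⨍⁻ y in rationalBall X i, h y ∂μ}
  have hI : Monotone I := fun N N' hN i hi => ⟨hi.1.trans (by exact_mod_cast hN), hi.2⟩
  have hunion : {x | t < uncenteredMaximal μ h x} = ⋃ N, ⋃ i : I N, rationalBall X i := by
    ext x
    simp only [mem_ofPred_eq, lt_uncenteredMaximal_iff, mem_iUnion, Subtype.exists, exists_prop]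
    constructor
    · rintro ⟨i, hx, hi⟩
      obtain ⟨N, hN⟩ := exists_nat_ge ((i.2 : ℚ) : ℝ)
      exact ⟨N, i, ⟨hN, hi⟩, hx⟩
    · rintro ⟨N, i, hi, hx⟩
      exact ⟨i, hx, hi.2⟩
  have hmono : Monotone fun N => ⋃ i : I N, rationalBall X (i : ℕ × {q : ℚ // 0 < q}) :=
    fun N N' hN => iUnion_mono' fun i => ⟨⟨i, hI hN i.2⟩, subset_rfl⟩
  rw [hunion, hmono.measure_iUnion, ENNReal.mul_iSup]
  exact iSup_le fun N => hμ.mul_measure_iUnion_ball_le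
    (fun i => by exact_mod_cast i.1.2.2) (fun i => i.2.1) (fun i => i.2.2)

lemma IsDoubling.ofReal_mul_measure_lt_uncenteredMaximal_le (hμ : IsDoubling μ D)
    (hh : Measurable h) (t : ℝ) :
    ENNReal.ofReal t * μ {x | ENNReal.ofReal t < uncenteredMaximal μ h x} ≤
      2 * D * μ.withDensity h {x | ENNReal.ofReal t < 2 * h x} := by
  set E : Set X := {x | ENNReal.ofReal t < 2 * h x}
  have hE : MeasurableSet E := measurableSet_lt measurable_const (hh.const_mul 2)
  have htrunc : ∀ y, h y ≤ ENNReal.ofReal t / 2 + E.indicator h y := fun y => by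
    by_cases hy : y ∈ E
    · simp [hy]
    · rw [indicator_of_notMem hy, add_zero, ENNReal.le_div_iff_mul_le (by simp) (by simp), mul_comm]
      exact not_lt.1 hy
  have hsub : {x | ENNReal.ofReal t < uncenteredMaximal μ h x} ⊆
      {x | ENNReal.ofReal t / 2 < uncenteredMaximal μ (E.indicator h) x} := fun x hx => by
    refine lt_of_add_lt_add_left (a := ENNReal.ofReal t / 2) ?_
    rw [ENNReal.add_halves]
    exact lt_of_lt_of_le hx (uncenteredMaximal_le_add htrunc)
  calc ENNReal.ofReal t * μ {x | ENNReal.ofReal t < uncenteredMaximal μ h x}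
      ≤ ENNReal.ofReal t *
          μ {x | ENNReal.ofReal t / 2 < uncenteredMaximal μ (E.indicator h) x} := by
        gcongr
    _ = 2 * (ENNReal.ofReal t / 2 *
          μ {x | ENNReal.ofReal t / 2 < uncenteredMaximal μ (E.indicator h) x}) := by
        rw [← mul_assoc, ENNReal.mul_div_cancel two_ne_zero ENNReal.ofNat_ne_top]
    _ ≤ 2 * (D * ∫⁻ x, E.indicator h x ∂μ) := by
        gcongr 2 * ?_
        exact hμ.mul_measure_lt_uncenteredMaximal_le _ _
    _ = 2 * D * μ.withDensity h E := by
        rw [lintegral_indicator hE, withDensity_apply h hE, mul_assoc]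

/-- The constant of the Hardy–Littlewood maximal inequality in `L^q` for a measure with doubling
constant `D`. -/
def hardyLittlewoodConst (q : ℝ) (D : ℝ≥0∞) : ℝ≥0∞ :=
  ENNReal.ofReal q * (2 * D * (2 ^ (q - 1) / ENNReal.ofReal (q - 1)))

lemma hardyLittlewoodConst_ne_top {q : ℝ} (hq : 1 < q) (hD : D ≠ ∞) :
    hardyLittlewoodConst q D ≠ ∞ := by
  have hq0 : ENNReal.ofReal (q - 1) ≠ 0 := by simpa using hq
  rw [hardyLittlewoodConst]
  finiteness [sub_pos.2 hq]

theorem IsDoubling.lintegral_uncenteredMaximal_rpow_le (hμ : IsDoubling μ D) {q : ℝ}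
    (hq : 1 < q) (hh : Measurable h) :
    ∫⁻ x, uncenteredMaximal μ h x ^ q ∂μ ≤ hardyLittlewoodConst q D * ∫⁻ x, h x ^ q ∂μ := by
  have hq1 : 0 < q - 1 := sub_pos.2 hq
  have hq0 : ENNReal.ofReal (q - 1) ≠ 0 := by simpa using hq1
  have hD : D ≠ ∞ := hμ.ne_top
  set ν := μ.withDensity h
  have hν : ∫⁻ x, (2 * h x) ^ (q - 1) ∂ν = 2 ^ (q - 1) * ∫⁻ x, h x ^ q ∂μ := by
    rw [lintegral_withDensity_eq_lintegral_mul μ hh (by fun_prop),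
      ← lintegral_const_mul _ (hh.pow_const q)]
    refine lintegral_congr fun x => ?_
    have hpow : h x ^ q = h x * h x ^ (q - 1) := by
      simpa using ENNReal.rpow_add_of_nonneg (x := h x) 1 (q - 1) zero_le_one hq1.le
    rw [Pi.mul_apply, ENNReal.mul_rpow_of_nonneg _ _ hq1.le, hpow]
    ring
  calc ∫⁻ x, uncenteredMaximal μ h x ^ q ∂μ
      = ENNReal.ofReal q * ∫⁻ t in Ioi (0 : ℝ),
          μ {x | ENNReal.ofReal t < uncenteredMaximal μ h x} * ENNReal.ofReal (t ^ (q - 1)) :=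
        lintegral_rpow_eq_lintegral_meas_ofReal_lt_mul measurable_uncenteredMaximal.aemeasurable
          (by linarith)
    _ ≤ ENNReal.ofReal q * ∫⁻ t in Ioi (0 : ℝ),
          2 * D * (ν {x | ENNReal.ofReal t < 2 * h x} * ENNReal.ofReal (t ^ (q - 1 - 1))) := by
        gcongr ENNReal.ofReal q * ?_
        refine setLIntegral_mono' measurableSet_Ioi fun t ht => ?_
        have ht0 : 0 < t := ht
        have hpow : ENNReal.ofReal (t ^ (q - 1)) =
            ENNReal.ofReal t * ENNReal.ofReal (t ^ (q - 1 - 1)) := by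
          rw [← ENNReal.ofReal_mul ht0.le, Real.rpow_sub_one ht0.ne' (q - 1),
            mul_div_cancel₀ _ ht0.ne']
        rw [hpow, ← mul_assoc, mul_comm (μ _), ← mul_assoc]
        gcongr ?_ * _
        exact hμ.ofReal_mul_measure_lt_uncenteredMaximal_le hh t
    _ = ENNReal.ofReal q * (2 * D * ((∫⁻ x, (2 * h x) ^ (q - 1) ∂ν) / ENNReal.ofReal (q - 1))) := by
        rw [lintegral_const_mul' _ _ (by finiteness),
          lintegral_rpow_eq_lintegral_meas_ofReal_lt_mul (by fun_prop) hq1,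
          mul_comm (ENNReal.ofReal (q - 1)), ENNReal.mul_div_cancel_right hq0 ENNReal.ofReal_ne_top]
    _ = hardyLittlewoodConst q D * ∫⁻ x, h x ^ q ∂μ := by
        rw [hν, hardyLittlewoodConst, div_eq_mul_inv, div_eq_mul_inv]
        ring

lemma IsDoubling.ae_uncenteredMaximal_lt_top (hμ : IsDoubling μ D) {q : ℝ} (hq : 1 < q)
    (hh : Measurable h) (hfin : ∫⁻ x, h x ^ q ∂μ ≠ ∞) :
    ∀ᵐ x ∂μ, uncenteredMaximal μ h x < ∞ := by
  have hlt : ∫⁻ x, uncenteredMaximal μ h x ^ q ∂μ ≠ ∞ :=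
    ne_top_of_le_ne_top (ENNReal.mul_ne_top (hardyLittlewoodConst_ne_top hq hμ.ne_top) hfin)
      (hμ.lintegral_uncenteredMaximal_rpow_le hq hh)
  filter_upwards [ae_lt_top (measurable_uncenteredMaximal.pow_const q) hlt] with x hx
  exact (ENNReal.rpow_lt_top_iff_of_pos (one_pos.trans hq)).1 hx

end WeakType

end HardyLittlewood

section DualWeight

variable {X : Type*} {p q : ℝ} {w : X → ℝ≥0∞}

/-- The dual weight `w ^ (-1 / (p - 1))` of the theory of `A_p` weights. -/
def dualWeight (p : ℝ) (w : X → ℝ≥0∞) (x : X) : ℝ≥0∞ :=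
  w x ^ (-1 / (p - 1))

lemma dualWeight_eq_rpow (hpq : p.HolderConjugate q) (x : X) :
    dualWeight p w x = w x ^ (1 - q) := by
  rw [dualWeight]
  congr 1
  have := hpq.sub_one_ne_zero
  field_simp
  linear_combination hpq.mul_eq_add

lemma dualWeight_dualWeight (hpq : p.HolderConjugate q) : dualWeight q (dualWeight p w) = w := by
  funext x
  rw [dualWeight_eq_rpow hpq.symm, dualWeight_eq_rpow hpq, ← ENNReal.rpow_mul]
  convert ENNReal.rpow_one (w x) using 2
  linear_combination hpq.mul_eq_add

lemma dualWeight_ne_zero {x : X} (h0 : w x ≠ 0) (htop : w x ≠ ∞) : dualWeight p w x ≠ 0 :=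
  (ENNReal.rpow_pos (pos_iff_ne_zero.2 h0) htop).ne'

lemma dualWeight_ne_top {x : X} (h0 : w x ≠ 0) (htop : w x ≠ ∞) : dualWeight p w x ≠ ∞ :=
  ENNReal.rpow_ne_top_of_ne_zero h0 htop

variable [MeasurableSpace X] {μ : Measure X}

lemma measurable_dualWeight (hw : Measurable w) : Measurable (dualWeight p w) :=
  hw.pow_const _

lemma measure_rpow_le_lintegral_mul_dualWeight (hpq : p.HolderConjugate q) (hm : Measurable w)
    (h0 : ∀ᵐ x ∂μ, w x ≠ 0) (htop : ∀ᵐ x ∂μ, w x ≠ ∞) (s : Set X) :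
    μ s ^ p ≤ (∫⁻ x in s, w x ∂μ) * (∫⁻ x in s, dualWeight p w x ∂μ) ^ (p - 1) := by
  have hone : ∫⁻ x in s, w x ^ (1 / p) * w x ^ (-1 / p) ∂μ = μ s := by
    rw [← setLIntegral_one]
    refine lintegral_congr_ae ?_
    filter_upwards [ae_restrict_of_ae h0, ae_restrict_of_ae htop] with x hx0 hxt
    rw [← ENNReal.rpow_add _ _ hx0 hxt, show 1 / p + -1 / p = 0 by ring, ENNReal.rpow_zero]
  have hleft : ∀ x, (w x ^ (1 / p)) ^ p = w x := fun x => by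
    rw [← ENNReal.rpow_mul, one_div_mul_cancel hpq.ne_zero, ENNReal.rpow_one]
  have hright : ∀ x, (w x ^ (-1 / p)) ^ q = dualWeight p w x := fun x => by
    rw [← ENNReal.rpow_mul, dualWeight, hpq.conjugate_eq]
    congr 1
    have := hpq.ne_zero
    field_simp
  have hholder := ENNReal.lintegral_mul_le_Lp_mul_Lq (μ.restrict s) hpq
    (hm.pow_const (1 / p)).aemeasurable (hm.pow_const (-1 / p)).aemeasurable
  simp only [Pi.mul_apply, hone, hleft, hright] at hholder
  calc μ s ^ p
      ≤ ((∫⁻ x in s, w x ∂μ) ^ (1 / p) * (∫⁻ x in s, dualWeight p w x ∂μ) ^ (1 / q)) ^ p :=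
        ENNReal.rpow_le_rpow hholder hpq.nonneg
    _ = _ := by
      rw [ENNReal.mul_rpow_of_nonneg _ _ hpq.nonneg, ← ENNReal.rpow_mul, ← ENNReal.rpow_mul,
        one_div_mul_cancel hpq.ne_zero, ENNReal.rpow_one, one_div_mul_eq_div,
        hpq.div_conj_eq_sub_one]

lemma setLAverage_withDensity_mul_inv (hm : Measurable w) (h0 : ∀ᵐ x ∂μ, w x ≠ 0)
    (htop : ∀ᵐ x ∂μ, w x ≠ ∞) (g : X → ℝ≥0∞) {s : Set X} (hs : MeasurableSet s) :
    ⨍⁻ z in s, g z * (w z)⁻¹ ∂(μ.withDensity w) = (∫⁻ z in s, g z ∂μ) / ∫⁻ z in s, w z ∂μ := by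
  rw [setLAverage_eq, withDensity_apply _ hs,
    setLIntegral_withDensity_eq_setLIntegral_mul_non_measurable _ hm _ hs
      (ae_restrict_of_ae (htop.mono fun _ => Ne.lt_top))]
  congr 1
  refine lintegral_congr_ae ?_
  filter_upwards [ae_restrict_of_ae h0, ae_restrict_of_ae htop] with z hz0 hztop
  rw [Pi.mul_apply, mul_left_comm, ENNReal.mul_inv_cancel hz0 hztop, mul_one]

end DualWeight

section WeightedMaximal

variable {X : Type*} [PseudoMetricSpace X] [TopologicalSpace.SeparableSpace X] [Nonempty X]
  [MeasurableSpace X] [OpensMeasurableSpace X] {μ : Measure X} {w : X → ℝ≥0∞}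

/-- The maximal function of the measure `g dμ` relative to the measure `w dμ`, that is, the supremum
of the ratios `(∫_B g dμ) / (∫_B w dμ)`. -/
def weightedMaximal (μ : Measure X) (w g : X → ℝ≥0∞) (x : X) : ℝ≥0∞ :=
  uncenteredMaximal (μ.withDensity w) (fun z => g z * (w z)⁻¹) x

lemma measurable_weightedMaximal {g : X → ℝ≥0∞} : Measurable (weightedMaximal μ w g) :=
  measurable_uncenteredMaximal

lemma IsDoubling.lintegral_weightedMaximal_rpow_le {D : ℝ≥0∞}
    (hD : IsDoubling (μ.withDensity w) D) {p q : ℝ} (hpq : p.HolderConjugate q)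
    (hm : Measurable w) (h0 : ∀ᵐ x ∂μ, w x ≠ 0) (htop : ∀ᵐ x ∂μ, w x ≠ ∞) {g : X → ℝ≥0∞}
    (hg : Measurable g) :
    ∫⁻ x, weightedMaximal μ w g x ^ q * w x ∂μ ≤
      hardyLittlewoodConst q D * ∫⁻ x, g x ^ q * dualWeight p w x ∂μ := by
  have hpow : ∫⁻ x, (g x * (w x)⁻¹) ^ q ∂(μ.withDensity w) =
      ∫⁻ x, g x ^ q * dualWeight p w x ∂μ := by
    rw [lintegral_withDensity_eq_lintegral_mul _ hm (by fun_prop)]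
    refine lintegral_congr_ae ?_
    filter_upwards [h0, htop] with x hx0 hxtop
    rw [Pi.mul_apply, ENNReal.mul_rpow_of_nonneg _ _ hpq.symm.nonneg, dualWeight_eq_rpow hpq,
      ENNReal.rpow_sub _ _ hx0 hxtop, ENNReal.rpow_one, ENNReal.inv_rpow, div_eq_mul_inv]
    ring
  calc ∫⁻ x, weightedMaximal μ w g x ^ q * w x ∂μ
      = ∫⁻ x, uncenteredMaximal (μ.withDensity w) (fun z => g z * (w z)⁻¹) x ^ q
          ∂(μ.withDensity w) := by
        rw [lintegral_withDensity_eq_lintegral_mul _ hm (measurable_uncenteredMaximal.pow_const q)]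
        simp only [weightedMaximal, Pi.mul_apply, mul_comm]
    _ ≤ _ := by
        rw [← hpow]
        exact hD.lintegral_uncenteredMaximal_rpow_le hpq.symm.lt (by fun_prop)

end WeightedMaximal

section BallAp

variable {X : Type*} [PseudoMetricSpace X] [MeasurableSpace X] {μ : Measure X} {p q : ℝ}
  {A K : ℝ≥0∞} {w : X → ℝ≥0∞}

/-- The `A_p` condition over balls, with finite constant `A`, for a weight with values in `[0, ∞]`
and an arbitrary reference measure. The averages are multiplied out. -/
structure BallAp (μ : Measure X) (p : ℝ) (A : ℝ≥0∞) (w : X → ℝ≥0∞) : Prop where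
  const_ne_top : A ≠ ∞
  measurable : Measurable w
  ae_ne_zero : ∀ᵐ x ∂μ, w x ≠ 0
  ae_ne_top : ∀ᵐ x ∂μ, w x ≠ ∞
  lintegral_ne_top : ∀ (c : X) (r : ℝ), ∫⁻ x in ball c r, w x ∂μ ≠ ∞
  bound : ∀ (c : X) {r : ℝ}, 0 < r →
    (∫⁻ x in ball c r, w x ∂μ) * (∫⁻ x in ball c r, dualWeight p w x ∂μ) ^ (p - 1) ≤
      A * μ (ball c r) ^ p

lemma BallAp.comp (hw : BallAp μ p A w) (T : X ≃ᵢ X) (hT : MeasurePreserving T μ μ)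
    (hTm : MeasurableEmbedding T) : BallAp μ p A (w ∘ T) := by
  have hball : ∀ (f : X → ℝ≥0∞) (c : X) (r : ℝ),
      ∫⁻ x in ball c r, f (T x) ∂μ = ∫⁻ x in ball (T c) r, f x ∂μ := fun f c r => by
    rw [← T.image_ball, hT.setLIntegral_comp_emb hTm]
  have hmeas : ∀ (c : X) (r : ℝ), μ (ball (T c) r) = μ (ball c r) := fun c r => by
    simpa using (hball (fun _ => 1) c r).symm
  refine ⟨hw.const_ne_top, hw.measurable.comp hT.measurable,
    hT.quasiMeasurePreserving.ae hw.ae_ne_zero, hT.quasiMeasurePreserving.ae hw.ae_ne_top,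
    fun c r => (hball w c r).trans_ne (hw.lintegral_ne_top _ _), fun c r hr => ?_⟩
  rw [← hmeas]
  exact (congrArg₂ _ (hball w c r) (congrArg (· ^ (p - 1)) (hball (dualWeight p w) c r))).trans_le
    (hw.bound (T c) hr)

section Dual

variable [μ.IsOpenPosMeasure]

lemma BallAp.lintegral_ne_zero (hw : BallAp μ p A w) (c : X) {r : ℝ} (hr : 0 < r) :
    ∫⁻ x in ball c r, w x ∂μ ≠ 0 := by
  intro h
  have : (ae (μ.restrict (ball c r))).NeBot := ae_restrict_neBot.2 (measure_ball_pos μ c hr).ne'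
  obtain ⟨x, hx, hx'⟩ := (((lintegral_eq_zero_iff hw.measurable).1 h).and
    (ae_restrict_of_ae hw.ae_ne_zero)).exists
  exact hx' hx

variable [ProperSpace X] [IsFiniteMeasureOnCompacts μ]

lemma BallAp.dual (hw : BallAp μ p A w) (hpq : p.HolderConjugate q) :
    BallAp μ q (A ^ (q - 1)) (dualWeight p w) where
  const_ne_top := ENNReal.rpow_ne_top_of_nonneg hpq.symm.sub_one_pos.le hw.const_ne_top
  measurable := measurable_dualWeight hw.measurable
  ae_ne_zero := by
    filter_upwards [hw.ae_ne_zero, hw.ae_ne_top] with x using dualWeight_ne_zero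
  ae_ne_top := by
    filter_upwards [hw.ae_ne_zero, hw.ae_ne_top] with x using dualWeight_ne_top
  lintegral_ne_top c r h := by
    rcases le_or_gt r 0 with hr | hr
    · simp [ball_eq_empty.2 hr] at h
    · have hbound := hw.bound c hr
      rw [h, ENNReal.top_rpow_of_pos hpq.sub_one_pos, ENNReal.mul_top (hw.lintegral_ne_zero c hr),
        top_le_iff] at hbound
      exact ENNReal.mul_ne_top hw.const_ne_top
        (ENNReal.rpow_ne_top_of_nonneg hpq.nonneg measure_ball_lt_top.ne) hbound
  bound c r hr := by
    have hq1 : 0 ≤ q - 1 := hpq.symm.sub_one_pos.le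
    have hmul : (p - 1) * (q - 1) = 1 := by linear_combination hpq.mul_eq_add
    have hmul' : p * (q - 1) = q := by linear_combination hpq.mul_eq_add
    have hbound := ENNReal.rpow_le_rpow (hw.bound c hr) hq1
    rw [ENNReal.mul_rpow_of_nonneg _ _ hq1, ENNReal.mul_rpow_of_nonneg _ _ hq1, ← ENNReal.rpow_mul,
      ← ENNReal.rpow_mul, hmul, hmul', ENNReal.rpow_one, mul_comm] at hbound
    rwa [dualWeight_dualWeight hpq]

lemma BallAp.isDoubling [OpensMeasurableSpace X] (hw : BallAp μ p A w)
    (hpq : p.HolderConjugate q) (hK : IsDoubling μ K) :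
    IsDoubling (μ.withDensity w) (A * K ^ p) where
  ne_top := ENNReal.mul_ne_top hw.const_ne_top (ENNReal.rpow_ne_top_of_nonneg hpq.nonneg hK.ne_top)
  measure_ball_le c r hr := by
    have hr6 : 0 < 6 * r := by positivity
    rw [withDensity_apply _ measurableSet_ball, withDensity_apply _ measurableSet_ball]
    set S := (∫⁻ x in ball c r, dualWeight p w x ∂μ) ^ (p - 1)
    have hS0 : S ≠ 0 := (ENNReal.rpow_pos (pos_iff_ne_zero.2
      ((hw.dual hpq).lintegral_ne_zero c hr)) ((hw.dual hpq).lintegral_ne_top c r)).ne'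
    have hStop : S ≠ ∞ := ENNReal.rpow_ne_top_of_nonneg hpq.sub_one_pos.le
      ((hw.dual hpq).lintegral_ne_top c r)
    refine (ENNReal.mul_le_mul_iff_left hS0 hStop).1 ?_
    calc (∫⁻ x in ball c (6 * r), w x ∂μ) * S
        ≤ (∫⁻ x in ball c (6 * r), w x ∂μ) *
            (∫⁻ x in ball c (6 * r), dualWeight p w x ∂μ) ^ (p - 1) := by
          have hsub : ball c r ⊆ ball c (6 * r) := ball_subset_ball (by linarith)
          exact mul_le_mul_right
            (ENNReal.rpow_le_rpow (lintegral_mono_set hsub) hpq.sub_one_pos.le) _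
      _ ≤ A * μ (ball c (6 * r)) ^ p := hw.bound c hr6
      _ ≤ A * (K * μ (ball c r)) ^ p :=
          mul_le_mul_right (ENNReal.rpow_le_rpow (hK.measure_ball_le c hr) hpq.nonneg) A
      _ = A * K ^ p * μ (ball c r) ^ p := by
          rw [ENNReal.mul_rpow_of_nonneg _ _ hpq.nonneg, mul_assoc]
      _ ≤ A * K ^ p * ((∫⁻ x in ball c r, w x ∂μ) * S) := by
          gcongr
          exact measure_rpow_le_lintegral_mul_dualWeight hpq hw.measurable hw.ae_ne_zero
            hw.ae_ne_top _
      _ = A * K ^ p * (∫⁻ x in ball c r, w x ∂μ) * S := (mul_assoc _ _ _).symm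

lemma BallAp.rpow_lintegral_dualWeight_div_le (hw : BallAp μ p A w) (hpq : p.HolderConjugate q)
    (c : X) {r : ℝ} (hr : 0 < r) :
    ((∫⁻ x in ball c r, dualWeight p w x ∂μ) / μ (ball c r)) ^ (p - 1) ≤
      A * (μ (ball c r) / ∫⁻ x in ball c r, w x ∂μ) := by
  have hB0 : μ (ball c r) ≠ 0 := (measure_ball_pos μ c hr).ne'
  have hBtop : μ (ball c r) ≠ ∞ := measure_ball_lt_top.ne
  have hB : μ (ball c r) ^ p = μ (ball c r) * μ (ball c r) ^ (p - 1) := by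
    conv_lhs => rw [← add_sub_cancel 1 p, ENNReal.rpow_add _ _ hB0 hBtop, ENNReal.rpow_one]
  rw [ENNReal.div_rpow_of_nonneg _ _ hpq.sub_one_pos.le, ENNReal.div_le_iff
      (ENNReal.rpow_pos (pos_iff_ne_zero.2 hB0) hBtop).ne'
      (ENNReal.rpow_ne_top_of_nonneg hpq.sub_one_pos.le hBtop), ← mul_div_assoc,
    ← ENNReal.mul_div_right_comm, ENNReal.le_div_iff_mul_le
      (Or.inl (hw.lintegral_ne_zero c hr)) (Or.inl (hw.lintegral_ne_top c r)), mul_comm, mul_assoc,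
    ← hB]
  exact hw.bound c hr

end Dual

section Muckenhoupt

variable [ProperSpace X] [OpensMeasurableSpace X] [IsFiniteMeasureOnCompacts μ]
  [μ.IsOpenPosMeasure]

lemma BallAp.setLAverage_rpow_le (hw : BallAp μ p A w) (hpq : p.HolderConjugate q)
    {g N : X → ℝ≥0∞} {c : X} {r : ℝ} (hr : 0 < r)
    (hN : ∀ y ∈ ball c r,
      (∫⁻ z in ball c r, g z ∂μ) / ∫⁻ z in ball c r, dualWeight p w z ∂μ ≤ N y) :
    (⨍⁻ z in ball c r, g z ∂μ) ^ (p - 1) ≤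
      A * ((∫⁻ y in ball c r, N y ^ (p - 1) ∂μ) / ∫⁻ y in ball c r, w y ∂μ) := by
  set B := ball c r
  set S := ∫⁻ z in B, dualWeight p w z ∂μ
  set a := (∫⁻ z in B, g z ∂μ) / S
  have ha : ∫⁻ z in B, g z ∂μ = a * S :=
    (ENNReal.div_mul_cancel ((hw.dual hpq).lintegral_ne_zero c hr)
      ((hw.dual hpq).lintegral_ne_top c r)).symm
  calc (⨍⁻ z in B, g z ∂μ) ^ (p - 1)
      = a ^ (p - 1) * (S / μ B) ^ (p - 1) := by
        rw [setLAverage_eq, ha, mul_div_assoc, ENNReal.mul_rpow_of_nonneg _ _ hpq.sub_one_pos.le]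
    _ ≤ a ^ (p - 1) * (A * (μ B / ∫⁻ y in B, w y ∂μ)) := by
        gcongr
        exact hw.rpow_lintegral_dualWeight_div_le hpq c hr
    _ = A * (a ^ (p - 1) * μ B / ∫⁻ y in B, w y ∂μ) := by
        rw [mul_left_comm, mul_div_assoc]
    _ ≤ A * ((∫⁻ y in B, N y ^ (p - 1) ∂μ) / ∫⁻ y in B, w y ∂μ) := by
        gcongr
        rw [← setLIntegral_const]
        exact setLIntegral_mono' measurableSet_ball
          fun y hy => ENNReal.rpow_le_rpow (hN y hy) hpq.sub_one_pos.le

variable [Nonempty X]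

-- Lerner's argument: the two weighted maximal functions are bounded for doubling weights alone.
lemma BallAp.uncenteredMaximal_rpow_le (hw : BallAp μ p A w) (hpq : p.HolderConjugate q)
    (g : X → ℝ≥0∞) (x : X) :
    uncenteredMaximal μ g x ^ (p - 1) ≤
      A * weightedMaximal μ w (fun y => weightedMaximal μ (dualWeight p w) g y ^ (p - 1)) x := by
  have hσ := hw.dual hpq
  rw [← ENNReal.le_rpow_inv_iff hpq.sub_one_pos]
  refine uncenteredMaximal_le fun i hx => ?_
  rw [ENNReal.le_rpow_inv_iff hpq.sub_one_pos]
  have hN : ∀ y ∈ rationalBall X i, (∫⁻ z in rationalBall X i, g z ∂μ) /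
      ∫⁻ z in rationalBall X i, dualWeight p w z ∂μ ≤ weightedMaximal μ (dualWeight p w) g y := by
    intro y hy
    rw [← setLAverage_withDensity_mul_inv hσ.measurable hσ.ae_ne_zero hσ.ae_ne_top _
      (measurableSet_rationalBall i)]
    exact setLAverage_le_uncenteredMaximal hy
  refine (hw.setLAverage_rpow_le hpq (by exact_mod_cast i.2.2) hN).trans ?_
  gcongr
  refine le_trans (le_of_eq ?_) (setLAverage_le_uncenteredMaximal hx)
  exact (setLAverage_withDensity_mul_inv hw.measurable hw.ae_ne_zero hw.ae_ne_top _
    (measurableSet_rationalBall i)).symm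

/-- The constant in Muckenhoupt's theorem for conjugate exponents `p` and `q`, a reference measure
with doubling constant `K` and a weight with `A_p` constant `A`. -/
def muckenhouptConst (p q : ℝ) (K A : ℝ≥0∞) : ℝ≥0∞ :=
  A ^ q * (hardyLittlewoodConst q (A * K ^ p) * hardyLittlewoodConst p (A ^ (q - 1) * K ^ q))

theorem BallAp.lintegral_uncenteredMaximal_rpow_mul_le (hw : BallAp μ p A w)
    (hpq : p.HolderConjugate q) (hK : IsDoubling μ K) {g : X → ℝ≥0∞} (hg : Measurable g) :
    ∫⁻ x, uncenteredMaximal μ g x ^ p * w x ∂μ ≤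
      muckenhouptConst p q K A * ∫⁻ x, g x ^ p * w x ∂μ := by
  have hσ := hw.dual hpq
  have hpq' : (p - 1) * q = p := by linear_combination hpq.mul_eq_add
  set σ := dualWeight p w
  set N := weightedMaximal μ σ g
  have hAq : A ^ q ≠ ∞ := ENNReal.rpow_ne_top_of_nonneg hpq.symm.nonneg hw.const_ne_top
  calc ∫⁻ x, uncenteredMaximal μ g x ^ p * w x ∂μ
      ≤ ∫⁻ x, A ^ q * (weightedMaximal μ w (fun y => N y ^ (p - 1)) x ^ q * w x) ∂μ := by
        refine lintegral_mono fun x => ?_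
        rw [← mul_assoc, ← ENNReal.mul_rpow_of_nonneg _ _ hpq.symm.nonneg]
        gcongr
        nth_rewrite 1 [← hpq']
        rw [ENNReal.rpow_mul]
        exact ENNReal.rpow_le_rpow (hw.uncenteredMaximal_rpow_le hpq g x) hpq.symm.nonneg
    _ ≤ A ^ q * (hardyLittlewoodConst q (A * K ^ p) * ∫⁻ x, N x ^ p * σ x ∂μ) := by
        rw [lintegral_const_mul' _ _ hAq]
        gcongr
        refine ((hw.isDoubling hpq hK).lintegral_weightedMaximal_rpow_le hpq hw.measurable
          hw.ae_ne_zero hw.ae_ne_top (measurable_weightedMaximal.pow_const _)).trans_eq ?_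
        simp only [← ENNReal.rpow_mul, hpq']
        rfl
    _ ≤ A ^ q * (hardyLittlewoodConst q (A * K ^ p) *
          (hardyLittlewoodConst p (A ^ (q - 1) * K ^ q) * ∫⁻ x, g x ^ p * w x ∂μ)) := by
        gcongr
        refine ((hσ.isDoubling hpq.symm hK).lintegral_weightedMaximal_rpow_le hpq.symm
          hσ.measurable hσ.ae_ne_zero hσ.ae_ne_top hg).trans_eq ?_
        rw [dualWeight_dualWeight hpq]
    _ = muckenhouptConst p q K A * ∫⁻ x, g x ^ p * w x ∂μ := by
        rw [muckenhouptConst]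
        ring

lemma muckenhouptConst_ne_top (hpq : p.HolderConjugate q) (hK : K ≠ ∞) (hA : A ≠ ∞) :
    muckenhouptConst p q K A ≠ ∞ := by
  have hpow : ∀ {a : ℝ≥0∞} {s : ℝ}, 0 ≤ s → a ≠ ∞ → a ^ s ≠ ∞ := ENNReal.rpow_ne_top_of_nonneg
  have hq1 : 0 ≤ q - 1 := hpq.symm.sub_one_pos.le
  exact ENNReal.mul_ne_top (hpow hpq.symm.nonneg hA) (ENNReal.mul_ne_top
    (hardyLittlewoodConst_ne_top hpq.symm.lt (ENNReal.mul_ne_top hA (hpow hpq.nonneg hK)))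
    (hardyLittlewoodConst_ne_top hpq.lt
      (ENNReal.mul_ne_top (hpow hq1 hA) (hpow hpq.symm.nonneg hK))))

end Muckenhoupt

end BallAp

section TwoVariables

variable {E : Type*} [NormedAddCommGroup E] [MeasureSpace E]

/-- The integral of `F x y ^ p` against the weight `w (x - y)`. -/
def weightedEnergy (p : ℝ) (w : E → ℝ≥0∞) (F : E → E → ℝ≥0∞) : ℝ≥0∞ :=
  ∫⁻ x, ∫⁻ y, F x y ^ p * w (x - y)

variable {p q : ℝ} {A K : ℝ≥0∞} {w : E → ℝ≥0∞} {F : E → E → ℝ≥0∞}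

lemma weightedEnergy_const_mul (hp : 0 ≤ p) {c : ℝ≥0∞} (hc : c ≠ ∞) (F : E → E → ℝ≥0∞) :
    weightedEnergy p w (fun x y => c * F x y) = c ^ p * weightedEnergy p w F := by
  have hcp : c ^ p ≠ ∞ := ENNReal.rpow_ne_top_of_nonneg hp hc
  simp only [weightedEnergy, ENNReal.mul_rpow_of_nonneg _ _ hp, mul_assoc,
    lintegral_const_mul' _ _ hcp]

variable [BorelSpace E]

lemma BallAp.comp_sub_right [(volume : Measure E).IsAddHaarMeasure]
    (hw : BallAp volume p A w) (y : E) : BallAp volume p A fun x => w (x - y) :=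
  hw.comp (IsometryEquiv.subRight y) (measurePreserving_sub_right volume y)
    (MeasurableEquiv.subRight y).measurableEmbedding

variable [ProperSpace E]

lemma measurable_energy_integrand (hw : Measurable w) (hF : Measurable (Function.uncurry F)) :
    Measurable (Function.uncurry fun x y => F x y ^ p * w (x - y)) :=
  (hF.pow_const p).mul (hw.comp measurable_sub)

lemma measurable_sheared (hF : Measurable (Function.uncurry F)) :
    Measurable (Function.uncurry fun z h => F z (z - h)) :=
  hF.comp (measurable_fst.prodMk measurable_sub)

variable [(volume : Measure E).IsAddHaarMeasure]

lemma weightedEnergy_add_le (hp : 1 ≤ p) (hw : Measurable w) {Φ Ψ : E → E → ℝ≥0∞}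
    (hΦ : Measurable (Function.uncurry Φ)) :
    weightedEnergy p w (fun x y => Φ x y + Ψ x y) ≤
      2 ^ (p - 1) * (weightedEnergy p w Φ + weightedEnergy p w Ψ) := by
  have h2 : (2 : ℝ≥0∞) ^ (p - 1) ≠ ∞ := by finiteness [sub_nonneg.2 hp]
  have hm : Measurable (Function.uncurry fun x y => Φ x y ^ p * w (x - y)) :=
    measurable_energy_integrand hw hΦ
  unfold weightedEnergy
  rw [← lintegral_add_left (Measurable.lintegral_prod_right hm), ← lintegral_const_mul' _ _ h2]
  refine lintegral_mono fun x => ?_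
  rw [← lintegral_add_left (hm.of_uncurry_left (x := x)), ← lintegral_const_mul' _ _ h2]
  refine lintegral_mono fun y => ?_
  rw [← add_mul, ← mul_assoc]
  gcongr
  exact ENNReal.rpow_add_le_mul_rpow_add_rpow _ _ hp

lemma weightedEnergy_swap (hw : Measurable w) (hF : Measurable (Function.uncurry F)) :
    weightedEnergy p w (fun x y => F y x) = weightedEnergy p (fun z => w (-z)) F := by
  have hm := measurable_energy_integrand (p := p) hw (F := fun x y => F y x)
    (hF.comp measurable_swap)
  rw [weightedEnergy, lintegral_lintegral_swap hm.aemeasurable]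
  simp only [weightedEnergy, neg_sub]

lemma BallAp.comp_sub_left (hw : BallAp volume p A w) (x : E) :
    BallAp volume p A fun y => w (x - y) :=
  hw.comp (IsometryEquiv.subLeft x) (Measure.measurePreserving_sub_left volume x)
    (MeasurableEquiv.subLeft x).measurableEmbedding

lemma BallAp.comp_neg (hw : BallAp volume p A w) : BallAp volume p A fun x : E => w (-x) :=
  hw.comp (IsometryEquiv.neg E) (Measure.measurePreserving_neg volume)
    (MeasurableEquiv.neg E).measurableEmbedding

/-- The maximal operator in the first variable. -/
def maxFst (F : E → E → ℝ≥0∞) (x y : E) : ℝ≥0∞ :=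
  uncenteredMaximal volume (fun z => F z y) x

/-- The maximal operator in the second variable. -/
def maxSnd (F : E → E → ℝ≥0∞) (x y : E) : ℝ≥0∞ :=
  uncenteredMaximal volume (fun z => F x z) y

/-- The maximal operator along the translates of the diagonal. -/
def maxDiag (F : E → E → ℝ≥0∞) (x y : E) : ℝ≥0∞ :=
  uncenteredMaximal volume (fun z => F z (z - (x - y))) x

lemma measurable_maxFst (hF : Measurable (Function.uncurry F)) :
    Measurable (Function.uncurry (maxFst F)) :=
  measurable_uncenteredMaximal_prod hF

lemma measurable_maxSnd (hF : Measurable (Function.uncurry F)) :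
    Measurable (Function.uncurry (maxSnd F)) :=
  (measurable_uncenteredMaximal_prod (F := fun z x => F x z) (hF.comp measurable_swap)).comp
    measurable_swap

lemma measurable_maxDiag (hF : Measurable (Function.uncurry F)) :
    Measurable (Function.uncurry (maxDiag F)) :=
  (measurable_uncenteredMaximal_prod (measurable_sheared hF)).comp
    (measurable_fst.prodMk measurable_sub)

lemma weightedEnergy_maxSnd_le (hw : BallAp volume p A w) (hpq : p.HolderConjugate q)
    (hK : IsDoubling (volume : Measure E) K) (hF : Measurable (Function.uncurry F)) :
    weightedEnergy p w (maxSnd F) ≤ muckenhouptConst p q K A * weightedEnergy p w F := by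
  rw [weightedEnergy, weightedEnergy,
    ← lintegral_const_mul' _ _ (muckenhouptConst_ne_top hpq hK.ne_top hw.const_ne_top)]
  exact lintegral_mono fun x => (hw.comp_sub_left x).lintegral_uncenteredMaximal_rpow_mul_le hpq hK
    (hF.comp measurable_prodMk_left)

lemma weightedEnergy_maxFst_le (hw : BallAp volume p A w) (hpq : p.HolderConjugate q)
    (hK : IsDoubling (volume : Measure E) K) (hF : Measurable (Function.uncurry F)) :
    weightedEnergy p w (maxFst F) ≤ muckenhouptConst p q K A * weightedEnergy p w F := by
  rw [weightedEnergy, weightedEnergy, lintegral_lintegral_swap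
      (measurable_energy_integrand hw.measurable (measurable_maxFst hF)).aemeasurable,
    lintegral_lintegral_swap (measurable_energy_integrand hw.measurable hF).aemeasurable,
    ← lintegral_const_mul' _ _ (muckenhouptConst_ne_top hpq hK.ne_top hw.const_ne_top)]
  exact lintegral_mono fun y => (hw.comp_sub_right y).lintegral_uncenteredMaximal_rpow_mul_le hpq hK
    (hF.comp measurable_prodMk_right)

lemma weightedEnergy_eq_sheared (hw : Measurable w) (hF : Measurable (Function.uncurry F)) :
    weightedEnergy p w F = ∫⁻ h, w h * ∫⁻ x, F x (x - h) ^ p := by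
  have hm := (measurable_sheared hF).pow_const p
  calc weightedEnergy p w F = ∫⁻ x, ∫⁻ h, F x (x - h) ^ p * w h := by
        refine lintegral_congr fun x => ?_
        rw [← lintegral_sub_left_eq_self _ x]
        simp only [sub_sub_cancel]
    _ = ∫⁻ h, ∫⁻ x, F x (x - h) ^ p * w h :=
        lintegral_lintegral_swap (hm.mul (hw.comp measurable_snd)).aemeasurable
    _ = ∫⁻ h, w h * ∫⁻ x, F x (x - h) ^ p := by
        refine lintegral_congr fun h => ?_
        rw [mul_comm]
        exact lintegral_mul_const _ (hm.comp measurable_prodMk_right)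

lemma weightedEnergy_maxDiag_le (hw : Measurable w) (hp : 1 < p)
    (hK : IsDoubling (volume : Measure E) K) (hF : Measurable (Function.uncurry F)) :
    weightedEnergy p w (maxDiag F) ≤ hardyLittlewoodConst p K * weightedEnergy p w F := by
  rw [weightedEnergy_eq_sheared hw (measurable_maxDiag hF), weightedEnergy_eq_sheared hw hF,
    ← lintegral_const_mul' _ _ (hardyLittlewoodConst_ne_top hp hK.ne_top)]
  refine lintegral_mono fun h => ?_
  simp only [maxDiag, sub_sub_cancel, mul_left_comm (hardyLittlewoodConst p K)]
  gcongr
  exact hK.lintegral_uncenteredMaximal_rpow_le hp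
    ((measurable_sheared hF).comp measurable_prodMk_right)

/-- The majorant of the difference quotients of a maximal function, built from the difference
quotient `S` of the function itself. -/
def majorant (S : E → E → ℝ≥0∞) (x y : E) : ℝ≥0∞ :=
  S x y + maxFst S x y + (maxDiag (maxSnd S) x y + maxDiag (maxFst S) x y)

lemma measurable_majorant {S : E → E → ℝ≥0∞} (hS : Measurable (Function.uncurry S)) :
    Measurable (Function.uncurry (majorant S)) :=
  (hS.add (measurable_maxFst hS)).add
    ((measurable_maxDiag (measurable_maxSnd hS)).add (measurable_maxDiag (measurable_maxFst hS)))

/-- The constant in the energy estimate of the majorant. -/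
def majorantConst (p q : ℝ) (K A : ℝ≥0∞) : ℝ≥0∞ :=
  2 ^ (p - 1) * (2 ^ (p - 1) * (1 + muckenhouptConst p q K A +
    2 * (hardyLittlewoodConst p K * muckenhouptConst p q K A)))

lemma majorantConst_ne_top (hpq : p.HolderConjugate q) (hK : K ≠ ∞) (hA : A ≠ ∞) :
    majorantConst p q K A ≠ ∞ := by
  unfold majorantConst
  finiteness [muckenhouptConst_ne_top hpq hK hA, hardyLittlewoodConst_ne_top hpq.lt hK,
    hpq.sub_one_pos]

lemma weightedEnergy_majorant_le (hw : BallAp volume p A w) (hpq : p.HolderConjugate q)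
    (hK : IsDoubling (volume : Measure E) K) (hF : Measurable (Function.uncurry F)) :
    weightedEnergy p w (majorant F) ≤ majorantConst p q K A * weightedEnergy p w F := by
  have hfst := measurable_maxFst hF
  have hsnd := measurable_maxSnd hF
  calc weightedEnergy p w (majorant F)
      ≤ 2 ^ (p - 1) * (weightedEnergy p w (fun x y => F x y + maxFst F x y) +
          weightedEnergy p w fun x y => maxDiag (maxSnd F) x y + maxDiag (maxFst F) x y) :=
        weightedEnergy_add_le hpq.lt.le hw.measurable (hF.add hfst)
    _ ≤ 2 ^ (p - 1) * (2 ^ (p - 1) * (weightedEnergy p w F + weightedEnergy p w (maxFst F)) +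
          2 ^ (p - 1) * (weightedEnergy p w (maxDiag (maxSnd F)) +
            weightedEnergy p w (maxDiag (maxFst F)))) := by
        gcongr
        · exact weightedEnergy_add_le hpq.lt.le hw.measurable hF
        · exact weightedEnergy_add_le hpq.lt.le hw.measurable (measurable_maxDiag hsnd)
    _ ≤ 2 ^ (p - 1) * (2 ^ (p - 1) * (weightedEnergy p w F +
          muckenhouptConst p q K A * weightedEnergy p w F) +
          2 ^ (p - 1) * (hardyLittlewoodConst p K *
            (muckenhouptConst p q K A * weightedEnergy p w F) + hardyLittlewoodConst p K *
            (muckenhouptConst p q K A * weightedEnergy p w F))) := by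
        gcongr
        · exact weightedEnergy_maxFst_le hw hpq hK hF
        · refine (weightedEnergy_maxDiag_le hw.measurable hpq.lt hK hsnd).trans ?_
          gcongr
          exact weightedEnergy_maxSnd_le hw hpq hK hF
        · refine (weightedEnergy_maxDiag_le hw.measurable hpq.lt hK hfst).trans ?_
          gcongr
          exact weightedEnergy_maxFst_le hw hpq hK hF
    _ = majorantConst p q K A * weightedEnergy p w F := by
        rw [majorantConst]
        ring

lemma weightedEnergy_majorant_add_swap_le (hw : BallAp volume p A w) (hpq : p.HolderConjugate q)
    (hK : IsDoubling (volume : Measure E) K) (hF : Measurable (Function.uncurry F))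
    (hsymm : ∀ x y, F x y = F y x) :
    weightedEnergy p w (fun x y => majorant F x y + majorant F y x) ≤
      2 ^ p * majorantConst p q K A * weightedEnergy p w F := by
  have hm := measurable_majorant hF
  have hneg : weightedEnergy p (fun z => w (-z)) F = weightedEnergy p w F := by
    rw [← weightedEnergy_swap hw.measurable hF]
    simp only [hsymm]
  calc weightedEnergy p w (fun x y => majorant F x y + majorant F y x)
      ≤ 2 ^ (p - 1) * (weightedEnergy p w (majorant F) +
          weightedEnergy p w fun x y => majorant F y x) :=
        weightedEnergy_add_le hpq.lt.le hw.measurable hm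
    _ ≤ 2 ^ (p - 1) * (majorantConst p q K A * weightedEnergy p w F +
          majorantConst p q K A * weightedEnergy p w F) := by
        gcongr
        · exact weightedEnergy_majorant_le hw hpq hK hF
        · rw [weightedEnergy_swap hw.measurable hm, ← hneg]
          exact weightedEnergy_majorant_le hw.comp_neg hpq hK hF
    _ = 2 ^ p * majorantConst p q K A * weightedEnergy p w F := by
        rw [show (2 : ℝ≥0∞) ^ p = 2 * 2 ^ (p - 1) by
          conv_lhs => rw [← add_sub_cancel 1 p,
            ENNReal.rpow_add _ _ two_ne_zero ENNReal.ofNat_ne_top, ENNReal.rpow_one]]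
        ring

end TwoVariables

section Haar

variable {E : Type*} [NormedAddCommGroup E] [NormedSpace ℝ E] [FiniteDimensional ℝ E]
  [MeasurableSpace E] [BorelSpace E] (μ : Measure E) [μ.IsAddHaarMeasure]

lemma isDoubling_addHaar : IsDoubling μ (ENNReal.ofReal (6 ^ Module.finrank ℝ E)) where
  ne_top := ENNReal.ofReal_ne_top
  measure_ball_le c r _ := by
    rw [Measure.addHaar_ball_mul_of_pos μ c (by norm_num), ← Measure.addHaar_ball_center μ c]

lemma setLAverage_ball_zero_one {g : E → ℝ≥0∞} (hg : Measurable g) (a : E) {r : ℝ} (hr : 0 < r) :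
    ⨍⁻ z in ball 0 1, g (a + r • z) ∂μ = ⨍⁻ y in ball a r, g y ∂μ := by
  have hφ : Measurable fun z : E => a + r • z := by fun_prop
  have hpre : (fun z : E => a + r • z) ⁻¹' ball a r = ball 0 1 := by
    ext z
    rw [mem_preimage, mem_ball, dist_eq_norm, add_sub_cancel_left, norm_smul,
      Real.norm_of_nonneg hr.le, mem_ball_zero_iff, mul_lt_iff_lt_one_right hr]
  have hmap : μ.map (fun z => a + r • z) = ENNReal.ofReal (r ^ Module.finrank ℝ E)⁻¹ • μ := by
    change μ.map ((a + ·) ∘ (r • ·)) = _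
    rw [← Measure.map_map (measurable_const_add a) (measurable_const_smul r),
      Measure.map_addHaar_smul μ hr.ne', abs_of_nonneg (by positivity), Measure.map_smul,
      map_add_left_eq_self]
  have hc : ENNReal.ofReal (r ^ Module.finrank ℝ E) ≠ 0 := by positivity
  rw [setLAverage_eq, setLAverage_eq, ← hpre, ← setLIntegral_map measurableSet_ball hg hφ, hmap,
    Measure.restrict_smul, lintegral_smul_measure, hpre, Measure.addHaar_ball_of_pos μ a hr,
    ENNReal.ofReal_inv_of_pos (by positivity), smul_eq_mul]
  simp only [div_eq_mul_inv, ENNReal.mul_inv (Or.inl hc) (Or.inl ENNReal.ofReal_ne_top)]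
  ring

end Haar

section DifferenceQuotient

variable {E F : Type*} [NormedAddCommGroup E] [NormedAddCommGroup F] {G : Set E} {s : ℝ} {f : E → F}

/-- The difference quotient of order `s` of `f`, extended by zero from `G × G`. On the diagonal its
value is `0`, since `0 / 0 = 0` in `[0, ∞]`. -/
def diffQuot (G : Set E) (s : ℝ) (f : E → F) (x y : E) : ℝ≥0∞ :=
  (G ×ˢ G).indicator (fun q => ‖f q.1 - f q.2‖ₑ / ENNReal.ofReal ‖q.1 - q.2‖ ^ s) (x, y)

lemma diffQuot_of_mem {x y : E} (hx : x ∈ G) (hy : y ∈ G) :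
    diffQuot G s f x y = ‖f x - f y‖ₑ / ENNReal.ofReal ‖x - y‖ ^ s :=
  indicator_of_mem (mk_mem_prod hx hy) _

lemma diffQuot_of_notMem {x y : E} (h : (x, y) ∉ G ×ˢ G) : diffQuot G s f x y = 0 :=
  indicator_of_notMem h _

lemma diffQuot_comm (G : Set E) (s : ℝ) (f : E → F) (x y : E) :
    diffQuot G s f x y = diffQuot G s f y x := by
  by_cases h : (x, y) ∈ G ×ˢ G
  · rw [diffQuot_of_mem h.1 h.2, diffQuot_of_mem h.2 h.1, norm_sub_rev, ← enorm_neg, neg_sub]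
  · rw [diffQuot_of_notMem h, diffQuot_of_notMem fun h' => h ⟨h'.2, h'.1⟩]

lemma measurable_diffQuot [MeasurableSpace E] [BorelSpace E] [SecondCountableTopology E]
    (hG : MeasurableSet G) (hf : StronglyMeasurable f) :
    Measurable (Function.uncurry (diffQuot G s f)) := by
  refine Measurable.indicator ?_ (hG.prod hG)
  have hnum : Measurable fun q : E × E => ‖f q.1 - f q.2‖ₑ :=
    ((hf.comp_measurable measurable_fst).sub (hf.comp_measurable measurable_snd)).enorm
  have hden : Measurable fun q : E × E => ‖q.1 - q.2‖ :=
    (continuous_fst.sub continuous_snd).norm.measurable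
  exact hnum.div (hden.ennreal_ofReal.pow_const s)

lemma enorm_le_add_mul_diffQuot (hs : 0 ≤ s) {a b : E} (ha : a ∈ G) (hb : b ∈ G) {t : ℝ}
    (h : ‖a - b‖ ≤ t) : ‖f a‖ₑ ≤ ‖f b‖ₑ + ENNReal.ofReal t ^ s * diffQuot G s f a b := by
  rcases eq_or_ne a b with rfl | hab
  · exact le_self_add
  have hpos : 0 < ENNReal.ofReal ‖a - b‖ := by simpa [sub_eq_zero] using hab
  calc ‖f a‖ₑ ≤ ‖f b‖ₑ + ‖f a - f b‖ₑ := by simpa using enorm_add_le (f b) (f a - f b)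
    _ = ‖f b‖ₑ + ENNReal.ofReal ‖a - b‖ ^ s * diffQuot G s f a b := by
        rw [diffQuot_of_mem ha hb, ENNReal.mul_div_cancel
          (ENNReal.rpow_pos hpos ENNReal.ofReal_ne_top).ne' (by finiteness)]
    _ ≤ ‖f b‖ₑ + ENNReal.ofReal t ^ s * diffQuot G s f a b := by gcongr

variable [MeasureSpace E] [BorelSpace E] [ProperSpace E] {K : ℝ≥0∞}

lemma setLAverage_ball_le_add_maxFst (hK : IsDoubling (volume : Measure E) K) (hs : 0 ≤ s)
    {x y : E} {r d : ℝ} (hr : 0 < r) (hrd : r ≤ d) (hxy : ‖x - y‖ ≤ d) (hy : y ∈ G)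
    (hball : ball x r ⊆ G) :
    ⨍⁻ z in ball x r, ‖f z‖ₑ ∂volume ≤
      ‖f y‖ₑ + ENNReal.ofReal (2 * d) ^ s * (K * maxFst (diffQuot G s f) x y) := by
  calc ⨍⁻ z in ball x r, ‖f z‖ₑ ∂volume
      ≤ ‖f y‖ₑ + ENNReal.ofReal (2 * d) ^ s * ⨍⁻ z in ball x r, diffQuot G s f z y ∂volume := by
        refine setLAverage_le_const_add_mul measurableSet_ball (by finiteness) fun z hz =>
          enorm_le_add_mul_diffQuot hs (hball hz) hy ?_
        linarith [norm_sub_le_norm_sub_add_norm_sub z x y, mem_ball_iff_norm.1 hz]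
    _ ≤ _ := by
        gcongr
        exact hK.setLAverage_ball_le hr (by simpa using hr.le)

variable [(volume : Measure E).IsAddHaarMeasure]

-- Average the triangle inequality through `f z` over `z ∈ ball c d`.
lemma enorm_le_add_maxSnd_add_maxFst (hK : IsDoubling (volume : Measure E) K)
    (hG : MeasurableSet G) (hs : 0 ≤ s) (hf : StronglyMeasurable f) {a b c u v : E} {d : ℝ}
    (hd : 0 < d) (ha : a ∈ G) (hb : b ∈ G) (hball : ball c d ⊆ G) (hac : ‖a - c‖ ≤ d)
    (hcb : ‖c - b‖ ≤ d) (hu : dist u c ≤ 2 * d) (hv : dist v c ≤ 2 * d) :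
    ‖f a‖ₑ ≤ ‖f b‖ₑ + ENNReal.ofReal (2 * d) ^ s *
      (K * (maxSnd (diffQuot G s f) a u + maxFst (diffQuot G s f) v b)) := by
  set S := diffQuot G s f
  set T := ENNReal.ofReal (2 * d) ^ s
  have hT : T ≠ ∞ := by finiteness
  have hpt : ∀ z ∈ ball c d, ‖f a‖ₑ ≤ ‖f b‖ₑ + T * S z b + T * S a z := by
    intro z hz
    have hzc := mem_ball_iff_norm.1 hz
    have haz : ‖a - z‖ ≤ 2 * d := by
      linarith [norm_sub_le_norm_sub_add_norm_sub a c z, norm_sub_rev c z]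
    have hzb : ‖z - b‖ ≤ 2 * d := by linarith [norm_sub_le_norm_sub_add_norm_sub z c b]
    exact (enorm_le_add_mul_diffQuot hs ha (hball hz) haz).trans
      (by gcongr; exact enorm_le_add_mul_diffQuot hs (hball hz) hb hzb)
  have hSb : Measurable fun z => S z b := (measurable_diffQuot hG hf).of_uncurry_right
  calc ‖f a‖ₑ = ⨍⁻ _ in ball c d, ‖f a‖ₑ ∂volume :=
        (setLAverage_const (measure_ball_pos _ c hd).ne' measure_ball_lt_top.ne _).symm
    _ ≤ ⨍⁻ z in ball c d, (‖f b‖ₑ + T * S z b) ∂volume + T * ⨍⁻ z in ball c d, S a z ∂volume :=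
        setLAverage_le_add_mul measurableSet_ball ((hSb.const_mul T).const_add _) hT hpt
    _ ≤ ‖f b‖ₑ + T * (⨍⁻ z in ball c d, S z b ∂volume) + T * ⨍⁻ z in ball c d, S a z ∂volume := by
        gcongr
        exact setLAverage_le_const_add_mul measurableSet_ball hT fun _ _ => le_rfl
    _ ≤ ‖f b‖ₑ + T * (K * maxFst S v b) + T * (K * maxSnd S a u) := by
        gcongr
        · exact hK.setLAverage_ball_le hd hv
        · exact hK.setLAverage_ball_le hd hu
    _ = _ := by ring

end DifferenceQuotient

section MovingBalls

variable {E F : Type*} [NormedAddCommGroup E] [NormedSpace ℝ E] [FiniteDimensional ℝ E]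
  [MeasureSpace E] [BorelSpace E] [(volume : Measure E).IsAddHaarMeasure] [NormedAddCommGroup F]
  {G : Set E} {s : ℝ} {f : E → F} {K : ℝ≥0∞}

lemma setLAverage_translate_le_maxDiag (hK : IsDoubling (volume : Measure E) K)
    {Φ : E → E → ℝ≥0∞} (hΦ : Measurable (Function.uncurry Φ)) (x y : E) {t : ℝ} (ht : 0 < t) :
    ⨍⁻ z in ball (0 : E) 1, Φ (x + t • z) (y + t • z) ∂volume ≤ K * maxDiag Φ x y := by
  calc ⨍⁻ z in ball (0 : E) 1, Φ (x + t • z) (y + t • z) ∂volume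
      = ⨍⁻ z in ball (0 : E) 1, Φ (x + t • z) (x + t • z - (x - y)) ∂volume := by
        congr! 3
        abel
    _ = ⨍⁻ v in ball x t, Φ v (v - (x - y)) ∂volume :=
        setLAverage_ball_zero_one volume
          ((measurable_sheared hΦ).comp measurable_prodMk_right) x ht
    _ ≤ K * maxDiag Φ x y := hK.setLAverage_ball_le ht (by simpa using ht.le)

lemma enorm_le_add_of_moving_balls (hK : IsDoubling (volume : Measure E) K)
    (hG : MeasurableSet G) (hs : 0 ≤ s) (hf : StronglyMeasurable f) {x y : E} {ρ d : ℝ}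
    (hρ : 0 < ρ) (hd : 0 < d) (hxy : ‖x - y‖ ≤ d) (hx : ball x (ρ + d) ⊆ G) (hy : ball y ρ ⊆ G)
    {z : E} (hz : ‖z‖ < 1) :
    ‖f (x + (ρ + d) • z)‖ₑ ≤ ‖f (y + ρ • z)‖ₑ + ENNReal.ofReal (2 * d) ^ s *
      (K * (maxSnd (diffQuot G s f) (x + (ρ + d) • z) (y + (ρ + d) • z) +
        maxFst (diffQuot G s f) (x + ρ • z) (y + ρ • z))) := by
  have hmem : ∀ {c : E} {t : ℝ}, 0 < t → c + t • z ∈ ball c t := fun {c t} ht => by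
    rw [mem_ball_iff_norm, add_sub_cancel_left, norm_smul, Real.norm_of_nonneg ht.le]
    exact mul_lt_of_lt_one_right ht hz
  have hρz : ‖ρ • z‖ ≤ ρ := by simpa using (mem_ball_iff_norm.1 (hmem (c := (0 : E)) hρ)).le
  have hdz : ‖d • z‖ ≤ d := by simpa using (mem_ball_iff_norm.1 (hmem (c := (0 : E)) hd)).le
  refine enorm_le_add_maxSnd_add_maxFst (c := x + ρ • z) hK hG hs hf hd
    (hx (hmem (by positivity))) (hy (hmem hρ)) ((ball_subset_ball' ?_).trans hx) ?_ ?_ ?_ ?_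
  · rw [dist_eq_norm, add_sub_cancel_left]
    linarith
  · rwa [add_smul, ← add_assoc, add_sub_cancel_left]
  · rwa [add_sub_add_right_eq_sub]
  · rw [dist_eq_norm, add_smul, show y + (ρ • z + d • z) - (x + ρ • z) = d • z - (x - y) by abel]
    linarith [norm_sub_le (d • z) (x - y)]
  · simpa using hd.le

lemma setLAverage_ball_le_add_maxDiag (hK : IsDoubling (volume : Measure E) K)
    (hG : MeasurableSet G) (hs : 0 ≤ s) (hf : StronglyMeasurable f) {x y : E} {ρ d : ℝ}
    (hρ : 0 < ρ) (hd : 0 < d) (hxy : ‖x - y‖ ≤ d) (hx : ball x (ρ + d) ⊆ G) (hy : ball y ρ ⊆ G) :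
    ⨍⁻ z in ball x (ρ + d), ‖f z‖ₑ ∂volume ≤ ⨍⁻ z in ball y ρ, ‖f z‖ₑ ∂volume +
      ENNReal.ofReal (2 * d) ^ s * (K ^ 2 *
        (maxDiag (maxSnd (diffQuot G s f)) x y + maxDiag (maxFst (diffQuot G s f)) x y)) := by
  set S := diffQuot G s f
  set T := ENNReal.ofReal (2 * d) ^ s * K
  have hS : Measurable (Function.uncurry S) := measurable_diffQuot hG hf
  have hT : T ≠ ∞ := by finiteness [hK.ne_top]
  have hr : 0 < ρ + d := by positivity
  have hfm : Measurable fun z => ‖f (y + ρ • z)‖ₑ := hf.enorm.comp (by fun_prop)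
  have hsnd : Measurable fun z => maxSnd S (x + (ρ + d) • z) (y + (ρ + d) • z) :=
    (measurable_maxSnd hS).comp (f := fun z => (x + (ρ + d) • z, y + (ρ + d) • z)) (by fun_prop)
  rw [← setLAverage_ball_zero_one volume hf.enorm x hr,
    ← setLAverage_ball_zero_one volume hf.enorm y hρ]
  calc ⨍⁻ z in ball (0 : E) 1, ‖f (x + (ρ + d) • z)‖ₑ ∂volume
      ≤ ⨍⁻ z in ball (0 : E) 1, (‖f (y + ρ • z)‖ₑ +
            T * maxSnd S (x + (ρ + d) • z) (y + (ρ + d) • z)) ∂volume +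
          T * ⨍⁻ z in ball (0 : E) 1, maxFst S (x + ρ • z) (y + ρ • z) ∂volume := by
        refine setLAverage_le_add_mul measurableSet_ball (hfm.add (hsnd.const_mul T)) hT
          fun z hz => (enorm_le_add_of_moving_balls hK hG hs hf hρ hd hxy hx hy
            (mem_ball_zero_iff.1 hz)).trans_eq (by ring)
    _ ≤ ⨍⁻ z in ball (0 : E) 1, ‖f (y + ρ • z)‖ₑ ∂volume +
            T * (⨍⁻ z in ball (0 : E) 1, maxSnd S (x + (ρ + d) • z) (y + (ρ + d) • z) ∂volume) +
          T * ⨍⁻ z in ball (0 : E) 1, maxFst S (x + ρ • z) (y + ρ • z) ∂volume := by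
        gcongr
        exact setLAverage_le_add_mul measurableSet_ball hfm hT fun _ _ => le_rfl
    _ ≤ ⨍⁻ z in ball (0 : E) 1, ‖f (y + ρ • z)‖ₑ ∂volume + T * (K * maxDiag (maxSnd S) x y) +
          T * (K * maxDiag (maxFst S) x y) := by
        gcongr
        · exact setLAverage_translate_le_maxDiag hK (measurable_maxSnd hS) x y hr
        · exact setLAverage_translate_le_maxDiag hK (measurable_maxFst hS) x y hρ
    _ = _ := by ring

end MovingBalls

section MaximalFunction

variable {n : ℕ} {𝕜 : Type*} [RCLike 𝕜] {G : Set (EuclideanSpace ℝ (Fin n))} {p s : ℝ}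
  {R : EuclideanSpace ℝ (Fin n) → ℝ} {f g : EuclideanSpace ℝ (Fin n) → 𝕜}
  {x y : EuclideanSpace ℝ (Fin n)} {K : ℝ≥0∞}

lemma ball_subset_of_le_infEDist_frontier {E : Type*} [NormedAddCommGroup E] [NormedSpace ℝ E]
    {G : Set E} (hG : IsOpen G) {x : E} (hx : x ∈ G) {r : ℝ}
    (h : ENNReal.ofReal r ≤ infEDist x (frontier G)) : ball x r ⊆ G := by
  rcases le_or_gt r 0 with hr | hr
  · simp [ball_eq_empty.2 hr]
  refine isPreconnected_ball.subset_left_of_subset_union hG isClosed_closure.isOpen_compl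
    (disjoint_compl_right.mono_left subset_closure) (fun z hz => ?_) ⟨x, mem_ball_self hr, hx⟩
  by_contra hcon
  rw [mem_union, not_or, notMem_compl_iff] at hcon
  have hzf : z ∈ frontier G := hG.frontier_eq ▸ ⟨hcon.2, hcon.1⟩
  have hxz : ENNReal.ofReal r ≤ edist x z := h.trans (infEDist_le_edist_of_mem hzf)
  rw [edist_dist, ENNReal.ofReal_le_ofReal_iff dist_nonneg] at hxz
  exact (mem_ball'.1 hz).not_ge hxz

lemma enorm_le_maximalFunction (h : 0 ≤ R x) : ‖f x‖ₑ ≤ maximalFunction R f x :=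
  (if_pos rfl).ge.trans (le_iSup₂ (f := fun r _ => ballAverage f x r) 0 ⟨le_rfl, h⟩)

lemma setLAverage_le_maximalFunction {r : ℝ} (hr : 0 < r) (hrR : r ≤ R x) :
    ⨍⁻ z in ball x r, ‖f z‖ₑ ∂volume ≤ maximalFunction R f x :=
  (if_neg hr.ne').ge.trans (le_iSup₂ (f := fun r _ => ballAverage f x r) r ⟨hr.le, hrR⟩)

lemma maximalFunction_le {b : ℝ≥0∞} (h0 : ‖f x‖ₑ ≤ b)
    (h : ∀ r, 0 < r → r ≤ R x → ⨍⁻ z in ball x r, ‖f z‖ₑ ∂volume ≤ b) :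
    maximalFunction R f x ≤ b := by
  refine iSup₂_le fun r hr => ?_
  rw [ballAverage]
  split_ifs with hr0
  · exact h0
  · exact h r (hr.1.lt_of_ne' hr0) hr.2

lemma maximalFunction_congr (hfg : f =ᵐ[volume.restrict G] g) (hx : f x = g x)
    (hball : ball x (R x) ⊆ G) : maximalFunction R f x = maximalFunction R g x := by
  refine biSup_congr fun r hr => ?_
  have hae : (fun z => ‖f z‖ₑ) =ᵐ[volume.restrict (ball x r)] fun z => ‖g z‖ₑ :=
    (hfg.filter_mono (ae_mono (Measure.restrict_mono_set _
      ((ball_subset_ball hr.2).trans hball)))).fun_comp enorm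
  rw [ballAverage, ballAverage, hx, laverage_congr hae]

lemma maximalFunction_ae_congr (hG : MeasurableSet G) (hball : ∀ x ∈ G, ball x (R x) ⊆ G)
    (hfg : f =ᵐ[volume.restrict G] g) :
    maximalFunction R f =ᵐ[volume.restrict G] maximalFunction R g := by
  filter_upwards [hfg, ae_restrict_mem hG] with x hx hxG
  exact maximalFunction_congr hfg hx (hball x hxG)

lemma maximalFunction_le_add_majorant
    (hK : IsDoubling (volume : Measure (EuclideanSpace ℝ (Fin n))) K) (hG : MeasurableSet G)
    (hs : 0 ≤ s) (hf : StronglyMeasurable f) (hx : x ∈ G) (hy : y ∈ G) (hRy : 0 ≤ R y)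
    (hballx : ball x (R x) ⊆ G) (hbally : ball y (R y) ⊆ G) :
    maximalFunction R f x ≤ maximalFunction R f y +
      ENNReal.ofReal (2 * (‖x - y‖ + |R x - R y|)) ^ s *
        (K ^ 2 * majorant (diffQuot G s f) x y) := by
  rcases eq_or_ne x y with rfl | hne
  · exact le_self_add
  set d := ‖x - y‖ + |R x - R y|
  have hd : 0 < d := add_pos_of_pos_of_nonneg (norm_sub_pos_iff.2 hne) (abs_nonneg _)
  have hxy : ‖x - y‖ ≤ d := le_add_of_nonneg_right (abs_nonneg _)
  have hfy : ‖f y‖ₑ ≤ maximalFunction R f y := enorm_le_maximalFunction hRy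
  have hK1 : 1 ≤ K := hK.one_le
  refine maximalFunction_le ?_ fun r hr hrR => ?_
  · refine (enorm_le_add_mul_diffQuot hs hx hy (t := 2 * d) (by linarith)).trans ?_
    gcongr
    refine le_mul_of_one_le_of_le (one_le_pow₀ hK1) ?_
    rw [majorant, add_assoc]
    exact le_self_add
  have hballr : ball x r ⊆ G := (ball_subset_ball hrR).trans hballx
  rcases le_or_gt r d with hrd | hdr
  · refine (setLAverage_ball_le_add_maxFst hK hs hr hrd hxy hy hballr).trans ?_
    gcongr
    · exact le_self_pow₀ hK1 two_ne_zero
    · exact le_add_right le_add_self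
  · obtain ⟨ρ, rfl⟩ : ∃ ρ, r = ρ + d := ⟨r - d, (sub_add_cancel r d).symm⟩
    have hρ : 0 < ρ := by linarith
    have hρR : ρ ≤ R y := by linarith [le_abs_self (R x - R y), norm_nonneg (x - y)]
    refine (setLAverage_ball_le_add_maxDiag hK hG hs hf hρ hd hxy hballr
      ((ball_subset_ball hρR).trans hbally)).trans ?_
    gcongr
    · exact setLAverage_le_maximalFunction hρ hρR
    · exact le_add_self

lemma enorm_toReal_sub_le {a b c c' : ℝ≥0∞} (ha : a ≠ ∞) (hb : b ≠ ∞) (h : a ≤ b + c)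
    (h' : b ≤ a + c') : ‖a.toReal - b.toReal‖ₑ ≤ c + c' := by
  rcases le_total b a with hab | hab
  · rw [← ENNReal.toReal_sub_of_le hab ha, Real.enorm_toReal (ENNReal.sub_ne_top ha)]
    exact (tsub_le_iff_left.2 h).trans le_self_add
  · rw [← enorm_neg, neg_sub, ← ENNReal.toReal_sub_of_le hab hb,
      Real.enorm_toReal (ENNReal.sub_ne_top hb)]
    exact (tsub_le_iff_left.2 h').trans le_add_self

lemma enorm_maximalFunction_sub_div_le
    (hK : IsDoubling (volume : Measure (EuclideanSpace ℝ (Fin n))) K) (hG : MeasurableSet G)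
    (hs : 0 ≤ s) (hf : StronglyMeasurable f) (hx : x ∈ G) (hy : y ∈ G) (hRx : 0 ≤ R x)
    (hRy : 0 ≤ R y) (hballx : ball x (R x) ⊆ G) (hbally : ball y (R y) ⊆ G)
    (hMx : maximalFunction R f x ≠ ∞) (hMy : maximalFunction R f y ≠ ∞) :
    ‖(maximalFunction R f x).toReal - (maximalFunction R f y).toReal‖ₑ /
        ENNReal.ofReal (‖x - y‖ + |R x - R y|) ^ s ≤
      2 ^ s * K ^ 2 * (majorant (diffQuot G s f) x y + majorant (diffQuot G s f) y x) := by
  have hxy := maximalFunction_le_add_majorant hK hG hs hf hx hy hRy hballx hbally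
  have hyx := maximalFunction_le_add_majorant hK hG hs hf hy hx hRx hbally hballx
  rw [norm_sub_rev, abs_sub_comm] at hyx
  refine ENNReal.div_le_of_le_mul ((enorm_toReal_sub_le hMx hMy hxy hyx).trans_eq ?_)
  rw [ENNReal.ofReal_mul zero_le_two, ENNReal.ofReal_ofNat, ENNReal.mul_rpow_of_nonneg _ _ hs]
  ring

lemma maximalFunction_le_add_uncenteredMaximal
    (hK : IsDoubling (volume : Measure (EuclideanSpace ℝ (Fin n))) K) (hball : ball x (R x) ⊆ G) :
    maximalFunction R f x ≤
      ‖f x‖ₑ + K * uncenteredMaximal volume (G.indicator fun z => ‖f z‖ₑ) x := by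
  refine maximalFunction_le le_self_add fun r hr hrR => ?_
  calc ⨍⁻ z in ball x r, ‖f z‖ₑ ∂volume
      = ⨍⁻ z in ball x r, G.indicator (fun z => ‖f z‖ₑ) z ∂volume :=
        setLAverage_congr_fun measurableSet_ball fun z hz =>
          (indicator_of_mem (hball (ball_subset_ball hrR hz)) fun z => ‖f z‖ₑ).symm
    _ ≤ K * uncenteredMaximal volume (G.indicator fun z => ‖f z‖ₑ) x :=
        hK.setLAverage_ball_le hr (by simpa using hr.le)
    _ ≤ _ := le_add_self

lemma ae_maximalFunction_lt_top (hp : 1 < p) (hG : MeasurableSet G)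
    (hball : ∀ x ∈ G, ball x (R x) ⊆ G) (hf : StronglyMeasurable f)
    (hLp : MemLp f (ENNReal.ofReal p) (volume.restrict G)) :
    ∀ᵐ x ∂volume.restrict G, maximalFunction R f x < ∞ := by
  have hp0 : 0 < p := one_pos.trans hp
  have hK := isDoubling_addHaar (volume : Measure (EuclideanSpace ℝ (Fin n)))
  have hfin : ∫⁻ x, G.indicator (fun z => ‖f z‖ₑ) x ^ p < ∞ := by
    have hcomp : (fun x => G.indicator (fun z => ‖f z‖ₑ) x ^ p) =
        G.indicator fun z => ‖f z‖ₑ ^ p :=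
      (indicator_comp_of_zero (g := fun a : ℝ≥0∞ => a ^ p) (ENNReal.zero_rpow_of_pos hp0)).symm
    rw [hcomp, lintegral_indicator hG]
    simpa only [ENNReal.toReal_ofReal hp0.le] using lintegral_rpow_enorm_lt_top_of_eLpNorm_lt_top
      (by simpa using hp0) ENNReal.ofReal_ne_top hLp.2
  filter_upwards [ae_restrict_mem hG, ae_restrict_of_ae
    (hK.ae_uncenteredMaximal_lt_top hp (hf.enorm.indicator hG) hfin.ne)] with x hxG hx
  exact (maximalFunction_le_add_uncenteredMaximal hK (hball x hxG)).trans_lt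
    (ENNReal.add_lt_top.2 ⟨enorm_lt_top, ENNReal.mul_lt_top hK.ne_top.lt_top hx⟩)

end MaximalFunction

section Seminorm

variable {n : ℕ} {𝕜 : Type*} [RCLike 𝕜] {G : Set (EuclideanSpace ℝ (Fin n))} {p s : ℝ}
  {R ω : EuclideanSpace ℝ (Fin n) → ℝ} {w : EuclideanSpace ℝ (Fin n) → ℝ≥0∞}
  {u v f : EuclideanSpace ℝ (Fin n) → 𝕜} {A K : ℝ≥0∞}

lemma seminormPow_congr (h : u =ᵐ[volume.restrict G] v) :
    seminormPow G s p ω u = seminormPow G s p ω v := by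
  refine lintegral_congr_ae ?_
  filter_upwards [h] with x hx
  refine lintegral_congr_ae ?_
  filter_upwards [h] with y hy
  rw [hx, hy]

lemma modifiedSeminormPow_congr (h : u =ᵐ[volume.restrict G] v) :
    modifiedSeminormPow G R s p ω u = modifiedSeminormPow G R s p ω v := by
  refine lintegral_congr_ae ?_
  filter_upwards [h] with x hx
  refine lintegral_congr_ae ?_
  filter_upwards [h] with y hy
  rw [hx, hy]

lemma ae_comp_sub_left (hwω : w =ᵐ[volume] fun x => ENNReal.ofReal (ω x))
    (x : EuclideanSpace ℝ (Fin n)) :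
    (fun y => w (x - y)) =ᵐ[volume] fun y => ENNReal.ofReal (ω (x - y)) :=
  (Measure.measurePreserving_sub_left volume x).quasiMeasurePreserving.ae hwω

lemma weightedEnergy_diffQuot (hp : 0 < p) (hG : MeasurableSet G)
    (hwω : w =ᵐ[volume] fun x => ENNReal.ofReal (ω x)) :
    weightedEnergy p w (diffQuot G s f) = seminormPow G s p ω f := by
  rw [weightedEnergy, seminormPow, ← lintegral_indicator hG]
  refine lintegral_congr fun x => ?_
  by_cases hx : x ∈ G
  · rw [indicator_of_mem hx, ← lintegral_indicator hG]
    refine lintegral_congr_ae ?_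
    filter_upwards [ae_comp_sub_left hwω x] with y hy
    by_cases hyG : y ∈ G
    · rw [indicator_of_mem hyG, diffQuot_of_mem hx hyG, ENNReal.div_rpow_of_nonneg _ _ hp.le,
        ← ENNReal.rpow_mul, hy]
    · rw [indicator_of_notMem hyG, diffQuot_of_notMem fun h => hyG h.2,
        ENNReal.zero_rpow_of_pos hp, zero_mul]
  · simp [indicator_of_notMem hx, diffQuot_of_notMem fun h : (x, _) ∈ G ×ˢ G => hx h.1, hp]

lemma modifiedSeminormPow_le_weightedEnergy (hp : 0 ≤ p)
    (hwω : w =ᵐ[volume] fun x => ENNReal.ofReal (ω x))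
    {F : EuclideanSpace ℝ (Fin n) → EuclideanSpace ℝ (Fin n) → ℝ≥0∞}
    (h : ∀ᵐ x ∂volume.restrict G, ∀ᵐ y ∂volume.restrict G,
      ‖u x - u y‖ₑ / ENNReal.ofReal (‖x - y‖ + |R x - R y|) ^ s ≤ F x y) :
    modifiedSeminormPow G R s p ω u ≤ weightedEnergy p w F := by
  refine (lintegral_mono_ae ?_).trans (setLIntegral_le_lintegral G _)
  filter_upwards [h] with x hx
  refine (lintegral_mono_ae ?_).trans (setLIntegral_le_lintegral G _)
  filter_upwards [hx, ae_restrict_of_ae (ae_comp_sub_left hwω x)] with y hxy hy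
  rw [hy, ENNReal.rpow_mul, ← ENNReal.div_rpow_of_nonneg _ _ hp]
  gcongr

theorem modifiedSeminormPow_maximalFunction_le {q : ℝ} (hpq : p.HolderConjugate q)
    (hK : IsDoubling (volume : Measure (EuclideanSpace ℝ (Fin n))) K) (hG : MeasurableSet G)
    (hs : 0 ≤ s) (hR : ∀ x ∈ G, 0 ≤ R x ∧ ball x (R x) ⊆ G) (hw : BallAp volume p A w)
    (hwω : w =ᵐ[volume] fun x => ENNReal.ofReal (ω x)) (hf : StronglyMeasurable f)
    (hfin : ∀ᵐ x ∂volume.restrict G, maximalFunction R f x < ∞) :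
    modifiedSeminormPow G R s p ω (fun x => (maximalFunction R f x).toReal) ≤
      (2 ^ s * K ^ 2) ^ p * (2 ^ p * majorantConst p q K A) * seminormPow G s p ω f := by
  set S := diffQuot G s f
  calc modifiedSeminormPow G R s p ω (fun x => (maximalFunction R f x).toReal)
      ≤ weightedEnergy p w fun x y => 2 ^ s * K ^ 2 * (majorant S x y + majorant S y x) := by
        refine modifiedSeminormPow_le_weightedEnergy hpq.nonneg hwω ?_
        filter_upwards [ae_restrict_mem hG, hfin] with x hx hMx
        filter_upwards [ae_restrict_mem hG, hfin] with y hy hMy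
        exact enorm_maximalFunction_sub_div_le hK hG hs hf hx hy (hR x hx).1 (hR y hy).1
          (hR x hx).2 (hR y hy).2 hMx.ne hMy.ne
    _ = (2 ^ s * K ^ 2) ^ p * weightedEnergy p w fun x y => majorant S x y + majorant S y x :=
        weightedEnergy_const_mul hpq.nonneg (by finiteness [hK.ne_top]) _
    _ ≤ (2 ^ s * K ^ 2) ^ p * (2 ^ p * majorantConst p q K A * weightedEnergy p w S) := by
        gcongr
        exact weightedEnergy_majorant_add_swap_le hw hpq hK (measurable_diffQuot hG hf)
          (diffQuot_comm G s f)
    _ = _ := by rw [weightedEnergy_diffQuot hpq.pos hG hwω, ← mul_assoc]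

end Seminorm

section Weight

variable {n : ℕ} {p : ℝ} {ω : EuclideanSpace ℝ (Fin n) → ℝ}

lemma ball_subset_cube (c : EuclideanSpace ℝ (Fin n)) (r : ℝ) : ball c r ⊆ cube c r :=
  fun y hy i => (PiLp.norm_apply_le (y - c) i).trans (mem_ball_iff_norm.1 hy).le

lemma cube_subset_ball (c : EuclideanSpace ℝ (Fin n)) {r : ℝ} (hr : 0 < r) :
    cube c r ⊆ ball c ((n + 1) * r) := by
  intro y hy
  rw [mem_ball_iff_norm, EuclideanSpace.norm_eq, Real.sqrt_lt' (by positivity)]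
  calc ∑ i, ‖(y - c) i‖ ^ 2 ≤ ∑ _i : Fin n, r ^ 2 :=
        Finset.sum_le_sum fun i _ => pow_le_pow_left₀ (norm_nonneg _) (hy i) 2
    _ = n * r ^ 2 := by simp
    _ < ((n + 1) * r) ^ 2 := by nlinarith [n.cast_nonneg (α := ℝ), pow_pos hr 2]

lemma volume_cube_le (c : EuclideanSpace ℝ (Fin n)) {r : ℝ} (hr : 0 < r) :
    volume (cube c r) ≤ ENNReal.ofReal ((n + 1) ^ n) * volume (ball c r) := by
  refine (measure_mono (cube_subset_ball c hr)).trans_eq ?_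
  rw [Measure.addHaar_ball_mul_of_pos _ c (by positivity), finrank_euclideanSpace_fin,
    ← Measure.addHaar_ball_center _ c]

lemma volume_cube_ne_zero (c : EuclideanSpace ℝ (Fin n)) {r : ℝ} (hr : 0 < r) :
    volume (cube c r) ≠ 0 :=
  ((measure_ball_pos volume c hr).trans_le (measure_mono (ball_subset_cube c r))).ne'

lemma volume_cube_ne_top (c : EuclideanSpace ℝ (Fin n)) {r : ℝ} (hr : 0 < r) :
    volume (cube c r) ≠ ∞ :=
  ((measure_mono (cube_subset_ball c hr)).trans_lt measure_ball_lt_top).ne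

lemma ApBound.lintegral_cube_mul_le (hp : 1 < p) {A : ℝ} (hA : ApBound p ω A)
    (c : EuclideanSpace ℝ (Fin n)) {r : ℝ} (hr : 0 < r) :
    (∫⁻ x in cube c r, ENNReal.ofReal (ω x)) *
        (∫⁻ x in cube c r, dualWeight p (fun x => ENNReal.ofReal (ω x)) x) ^ (p - 1) ≤
      ENNReal.ofReal A * volume (cube c r) ^ p := by
  have h0 := volume_cube_ne_zero c hr
  have htop := volume_cube_ne_top c hr
  have hp1 : 0 ≤ p - 1 := (sub_pos.2 hp).le
  have hpow : volume (cube c r) * volume (cube c r) ^ (p - 1) = volume (cube c r) ^ p := by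
    nth_rw 1 [← ENNReal.rpow_one (volume (cube c r))]
    rw [← ENNReal.rpow_add _ _ h0 htop, add_sub_cancel]
  rw [← hpow, ← ENNReal.div_le_iff (by positivity) (by finiteness),
    ENNReal.mul_div_mul_comm (Or.inr (by finiteness)) (Or.inl htop),
    ← ENNReal.div_rpow_of_nonneg _ _ hp1, ← setLAverage_eq, ← setLAverage_eq]
  exact hA c r hr

/-- A constant for the `A_p` condition over balls of a weight with constant `A` over cubes: a ball
of radius `r` lies in the cube of side `2 * r`, which lies in the ball of radius `(n + 1) * r`. -/
def ballApConst (n : ℕ) (p A : ℝ) : ℝ≥0∞ :=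
  ENNReal.ofReal A * ENNReal.ofReal ((n + 1) ^ n) ^ p

lemma ballApConst_ne_top (hp : 0 ≤ p) (A : ℝ) : ballApConst n p A ≠ ∞ :=
  ENNReal.mul_ne_top ENNReal.ofReal_ne_top
    (ENNReal.rpow_ne_top_of_nonneg hp ENNReal.ofReal_ne_top)

lemma ApBound.lintegral_ball_mul_le (hp : 1 < p) {A : ℝ} (hA : ApBound p ω A)
    (c : EuclideanSpace ℝ (Fin n)) {r : ℝ} (hr : 0 < r) :
    (∫⁻ x in ball c r, ENNReal.ofReal (ω x)) *
        (∫⁻ x in ball c r, dualWeight p (fun x => ENNReal.ofReal (ω x)) x) ^ (p - 1) ≤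
      ballApConst n p A * volume (ball c r) ^ p := by
  have hp0 : 0 ≤ p := (one_pos.trans hp).le
  calc (∫⁻ x in ball c r, ENNReal.ofReal (ω x)) *
        (∫⁻ x in ball c r, dualWeight p (fun x => ENNReal.ofReal (ω x)) x) ^ (p - 1)
      ≤ (∫⁻ x in cube c r, ENNReal.ofReal (ω x)) *
        (∫⁻ x in cube c r, dualWeight p (fun x => ENNReal.ofReal (ω x)) x) ^ (p - 1) := by
        gcongr
        all_goals exact ball_subset_cube c r
    _ ≤ ENNReal.ofReal A * volume (cube c r) ^ p := hA.lintegral_cube_mul_le hp c hr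
    _ ≤ ENNReal.ofReal A * (ENNReal.ofReal ((n + 1) ^ n) * volume (ball c r)) ^ p := by
        gcongr
        exact volume_cube_le c hr
    _ = ballApConst n p A * volume (ball c r) ^ p := by
        rw [ENNReal.mul_rpow_of_nonneg _ _ hp0, ballApConst, mul_assoc]

lemma IsWeight.exists_ballAp (hω : IsWeight ω) (hp : 1 < p) {A : ℝ} (hA : ApBound p ω A) :
    ∃ w : EuclideanSpace ℝ (Fin n) → ℝ≥0∞,
      BallAp volume p (ballApConst n p A) w ∧ w =ᵐ[volume] fun x => ENNReal.ofReal (ω x) := by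
  have hm : AEMeasurable (fun x => ENNReal.ofReal (ω x)) volume :=
    hω.1.aestronglyMeasurable.aemeasurable.ennreal_ofReal
  have hae : hm.mk =ᵐ[volume] fun x => ENNReal.ofReal (ω x) := hm.ae_eq_mk.symm
  have hdual : dualWeight p hm.mk =ᵐ[volume] dualWeight p fun x => ENNReal.ofReal (ω x) :=
    hae.fun_comp (· ^ (-1 / (p - 1)))
  refine ⟨hm.mk, ⟨ballApConst_ne_top (one_pos.trans hp).le A, hm.measurable_mk, ?_, ?_,
    fun c r => ?_, fun c r hr => ?_⟩, hae⟩
  · filter_upwards [hae, hω.2] with x hx h0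
    simpa [hx] using h0
  · filter_upwards [hae] with x hx
    simp [hx]
  · have hint : IntegrableOn ω (ball c r) volume :=
      (hω.1.integrableOn_isCompact (isCompact_closedBall c r)).mono_set ball_subset_closedBall
    rw [lintegral_congr_ae (ae_restrict_of_ae hae)]
    exact hint.lintegral_lt_top.ne
  · rw [lintegral_congr_ae (ae_restrict_of_ae hae), lintegral_congr_ae (ae_restrict_of_ae hdual)]
    exact hA.lintegral_ball_mul_le hp c hr

lemma IsApWeight.apBound_apConst_add_one (hω : IsApWeight p ω) :
    ApBound p ω (apConst p ω + 1) := by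
  obtain ⟨A, ⟨-, hA⟩, hlt⟩ := exists_lt_of_csInf_lt hω.2 (lt_add_one (apConst p ω))
  exact fun c r hr => (hA c r hr).trans (ENNReal.ofReal_le_ofReal hlt.le)

end Weight

/-- The constant of the theorem for exponents `s ≤ S` and weights with `[ω]_{A_p} = t`. The
infimum defining `[ω]_{A_p}` need not be one of the admissible constants, whence `t + 1`. -/
def sobolevConst (n : ℕ) (p S t : ℝ) : ℝ≥0∞ :=
  (2 ^ S * (6 ^ n) ^ 2) ^ p *
    (2 ^ p * majorantConst p p.conjExponent (6 ^ n) (ballApConst n p (t + 1)))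

lemma sobolevConst_ne_top {p : ℝ} (hp : 1 < p) (n : ℕ) (S t : ℝ) : sobolevConst n p S t ≠ ∞ := by
  have hp0 : 0 ≤ p := (one_pos.trans hp).le
  have hK : (6 : ℝ≥0∞) ^ n ≠ ∞ := by finiteness
  have hA : ballApConst n p (t + 1) ≠ ∞ := ballApConst_ne_top hp0 _
  unfold sobolevConst
  finiteness [majorantConst_ne_top (.conjExponent hp) hK hA]

lemma modifiedSeminormPow_maximalFunction_le_sobolevConst {n : ℕ} {𝕜 : Type*} [RCLike 𝕜]
    {G : Set (EuclideanSpace ℝ (Fin n))} {p s S : ℝ} {R ω : EuclideanSpace ℝ (Fin n) → ℝ}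
    {f : EuclideanSpace ℝ (Fin n) → 𝕜} (hp : 1 < p) (hG : MeasurableSet G) (hs : 0 ≤ s)
    (hsS : s ≤ S) (hR : ∀ x ∈ G, 0 ≤ R x ∧ ball x (R x) ⊆ G) (hω : IsApWeight p ω)
    (hf : StronglyMeasurable f)
    (hfin : ∀ᵐ x ∂volume.restrict G, maximalFunction R f x < ∞) :
    modifiedSeminormPow G R s p ω (fun x => (maximalFunction R f x).toReal) ≤
      sobolevConst n p S (apConst p ω) * seminormPow G s p ω f := by
  have hK : IsDoubling (volume : Measure (EuclideanSpace ℝ (Fin n))) (6 ^ n) := by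
    simpa [ENNReal.ofReal_pow] using
      isDoubling_addHaar (volume : Measure (EuclideanSpace ℝ (Fin n)))
  obtain ⟨w, hw, hwω⟩ := hω.1.exists_ballAp hp hω.apBound_apConst_add_one
  refine (modifiedSeminormPow_maximalFunction_le (.conjExponent hp) hK hG hs hR hw hwω hf
    hfin).trans ?_
  unfold sobolevConst
  gcongr
  exact one_le_two

end FracMaximal

end

theorem theorem4p1_general (n : ℕ) (p : ℝ) (hp : 1 < p) (S : ℝ) :
    ∃ C : ℝ → ℝ, (∀ t, 0 < C t) ∧
      ∀ (G : Set (EuclideanSpace ℝ (Fin n))), IsOpen G →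
      ∀ (s : ℝ), 0 ≤ s → s ≤ S →
      ∀ (R : EuclideanSpace ℝ (Fin n) → ℝ),
        (∀ x ∈ G, 0 ≤ R x ∧ ENNReal.ofReal (R x) ≤ Metric.infEDist x (frontier G)) →
      ∀ (ω : EuclideanSpace ℝ (Fin n) → ℝ), FracMaximal.IsApWeight p ω →
      ∀ (𝕜 : Type*) [RCLike 𝕜] (f : EuclideanSpace ℝ (Fin n) → 𝕜),
        MemLp f (ENNReal.ofReal p) (volume.restrict G) →
        (∀ᵐ x ∂(volume.restrict G), FracMaximal.maximalFunction R f x < ∞) ∧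
        FracMaximal.modifiedSeminormPow G R s p ω
            (fun x => (FracMaximal.maximalFunction R f x).toReal)
          ≤ ENNReal.ofReal (C (FracMaximal.apConst p ω)) *
              FracMaximal.seminormPow G s p ω f := by
  refine ⟨fun t => (FracMaximal.sobolevConst n p S t).toReal + 1, fun t => by positivity, ?_⟩
  intro G hG s hs hsS R hR ω hω 𝕜 _ f hf
  have hball : ∀ x ∈ G, 0 ≤ R x ∧ Metric.ball x (R x) ⊆ G := fun x hx =>
    ⟨(hR x hx).1, FracMaximal.ball_subset_of_le_infEDist_frontier hG hx (hR x hx).2⟩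
  have hGm := hG.measurableSet
  obtain ⟨g, hg, hfg⟩ := hf.1
  have hM := FracMaximal.maximalFunction_ae_congr hGm (fun x hx => (hball x hx).2) hfg
  have hfin := FracMaximal.ae_maximalFunction_lt_top hp hGm (fun x hx => (hball x hx).2) hg
    (hf.ae_eq hfg)
  refine ⟨by filter_upwards [hM, hfin] with x hx hgx using hx ▸ hgx, ?_⟩
  rw [FracMaximal.seminormPow_congr hfg]
  refine ((FracMaximal.modifiedSeminormPow_congr (hM.fun_comp ENNReal.toReal)).trans_le
    (FracMaximal.modifiedSeminormPow_maximalFunction_le_sobolevConst hp hGm hs hsS hball hω hg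
      hfin)).trans ?_
  gcongr
  exact (ENNReal.le_ofReal_iff_toReal_le (FracMaximal.sobolevConst_ne_top hp n S _)
    (by positivity)).2 (le_add_of_nonneg_right zero_le_one)

/-- The constant is `C [ω]_{A_p}` with a function `C` that is fixed once `n` and `p` are given. The
distance to the boundary is the extended one, so it is infinite when `∂G` is empty. -/
theorem theorem4p1 (n : ℕ) (p : ℝ) (hp : 1 < p) :
    ∃ C : ℝ → ℝ, (∀ t, 0 < C t) ∧
      ∀ (G : Set (EuclideanSpace ℝ (Fin n))), IsOpen G → G.Nonempty →
      ∀ (s : ℝ), 0 ≤ s → s ≤ 2 →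
      ∀ (R : EuclideanSpace ℝ (Fin n) → ℝ), Measurable (fun x : G => R x) →
        (∀ x ∈ G, 0 ≤ R x ∧ ENNReal.ofReal (R x) ≤ Metric.infEDist x (frontier G)) →
      ∀ (ω : EuclideanSpace ℝ (Fin n) → ℝ), FracMaximal.IsApWeight p ω →
      ∀ (𝕜 : Type) [RCLike 𝕜] (f : EuclideanSpace ℝ (Fin n) → 𝕜),
        MemLp f (ENNReal.ofReal p) (volume.restrict G) →
        (∀ᵐ x ∂(volume.restrict G), FracMaximal.maximalFunction R f x < ∞) ∧
        FracMaximal.modifiedSeminormPow G R s p ω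
            (fun x => (FracMaximal.maximalFunction R f x).toReal)
          ≤ ENNReal.ofReal (C (FracMaximal.apConst p ω)) *
              FracMaximal.seminormPow G s p ω f := by
  obtain ⟨C, hC, h⟩ := theorem4p1_general n p hp 2
  exact ⟨C, hC, fun G hG _ s hs hs2 R _ => h G hG s hs hs2 R⟩
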